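/- Let $A$ be an $n\times n$ Hermitian matrix (real symmetric or complex) with eigenvalues $\lambda_1,\dots,\lambda_n$ listed with multiplicity, let $\|A\|$ be its spectral norm, and let $u$ be uniformly distributed on the unit sphere $\mathbb S^{n-1}$ of $\mathbb R^n$. Lanczos algorithm: $v_0=u$ and, for $j=0,1,\dots$, $W_j=\mathrm{span}\{v_0,\dots,v_j\}$, $\alpha_j(u)=\langle Av_j,v_j\rangle$, $\beta_j(u)=\|\mathrm{Proj}_{W_j^\perp}(Av_j)\|$ and $v_{j+1}=\mathrm{Proj}_{W_j^\perp}(Av_j)/\beta_j(u)$ (with $v_{j+1}=0$ if $\beta_j(u)=0$). Let $J_k(u)$ be the $k\times k$ symmetric tridiagonal matrix with diagonal entries $\alpha_0(u),\dots,\alpha_{k-1}(u)$ and off-diagonal entries $\beta_0(u),\dots,\beta_{k-2}(u)$. For each $j$ let $\tilde\alpha_j$ and $\tilde\beta_j$ be medians of $\alpha_j(u)$ and $\beta_j(u)$, let $\tilde J_k$ be the $k\times k$ symmetric tridiagonal matrix with these entries, and let $\tilde r_1\ge\dots\ge\tilde r_k$ be its eigenvalues. Assume that $\{\lambda_1,\dots,\lambda_n\}$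 is $(\delta,\omega,k)$-equidistributed for some real $\delta,\omega>0$ and an integer $k\ge 2$, that is, for every nonempty finite set $T$ of at most $k$ real numbers, \[\Big|\Big\{l\in\{1,\dots,n\}:\ \frac1{|T|}\sum_{t\in T}\log|\lambda_l-t|\ge\log\omega\Big\}\Big|\ge\delta n,\qquad \log 0:=-\infty .\] Fix $1\le i\le k$, let $\tilde w_i$ and $w_i(u)$ be eigenvectors of $\tilde J_k$ and of $J_k(u)$ for their respective $i$-th largest eigenvalues, let $\theta\in[0,\pi/2]$ be the angle between $w_i(u)$ and $\tilde w_i$ (i.e. between the lines they span), and let $\varepsilon=\min_{j\ne i}|\tilde r_i-\tilde r_j|$. Then for every $0\le c<1/2$, \[\mathbf P\Big[\sin\theta\ge\frac{2\|A\|}{\varepsilon n^{c}}\Big]\le 4k\left[\exp\Big\{-\frac{\min\{\delta,1/50\}^2}{32}\,n\Big\}+\exp\Big\{-\frac1{192}\Big(\frac{\omega}{4\|A\|}\Big)^{2k}\delta^2 n^{1-2c}\Big\}\right].\] -/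

import Mathlib

open MeasureTheory

noncomputable section

namespace Lanczos

/-- The finite family `Λ` of `n` real numbers, counted with multiplicity, is
`(δ, ω, j)`-equidistributed: for every nonempty finite set `T` of at most `j` real numbers, at
least `δ n` members `x` of the family satisfy `(1 / |T|) ∑_{t ∈ T} log |x - t| ≥ log ω`.
The convention is `log 0 = -∞`, so members lying in `T` are never counted; this is the condition
`Λ i ∉ T`, needed because `Real.log 0 = 0`. -/
def IsEquidistributed {n : ℕ} (Λ : Fin n → ℝ) (δ ω : ℝ) (j : ℕ) : Prop :=
  ∀ T : Finset ℝ, T.Nonempty → T.card ≤ j →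
    δ * (n : ℝ) ≤
      (Set.ncard {i : Fin n | Λ i ∉ T ∧
        Real.log ω ≤ (1 / (T.card : ℝ)) * ∑ t ∈ T, Real.log |Λ i - t|} : ℝ)

/-- The unit sphere of `ℝⁿ`. -/
abbrev Sphere (n : ℕ) : Type := Metric.sphere (0 : EuclideanSpace ℝ (Fin n)) 1

/-- The uniform probability measure on the unit sphere of `ℝⁿ`: the normalized surface measure. -/
def unifSphere (n : ℕ) : Measure (Sphere n) :=
  ((volume : Measure (EuclideanSpace ℝ (Fin n))).toSphere Set.univ)⁻¹ •
    (volume : Measure (EuclideanSpace ℝ (Fin n))).toSphere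

/-- `m` is a median of the random variable `X` under `P`. -/
def IsMedian {Ω : Type*} [MeasurableSpace Ω] (P : Measure Ω) (X : Ω → ℝ) (m : ℝ) : Prop :=
  1 / 2 ≤ P {x | X x ≤ m} ∧ 1 / 2 ≤ P {x | m ≤ X x}

section Algorithm

variable {𝕜 : Type*} [RCLike 𝕜] {n : ℕ}

/-- A vector of `ℝⁿ` regarded as a vector of `𝕜ⁿ`, where `𝕜` is `ℝ` or `ℂ`. -/
def toField (𝕜 : Type*) [RCLike 𝕜] {n : ℕ} (u : EuclideanSpace ℝ (Fin n)) :
    EuclideanSpace 𝕜 (Fin n) :=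
  WithLp.toLp 2 fun i => ((u i : ℝ) : 𝕜)

/-- The spectral norm (`ℓ² → ℓ²` operator norm) of a matrix. -/
def specNorm (A : Matrix (Fin n) (Fin n) 𝕜) : ℝ :=
  ‖Matrix.toEuclideanCLM (n := Fin n) (𝕜 := 𝕜) A‖

/-- The component of `A v` orthogonal to the subspace `W`, that is `Proj_{Wᗮ} (A v)`. -/
def residual (A : Matrix (Fin n) (Fin n) 𝕜) (W : Submodule 𝕜 (EuclideanSpace 𝕜 (Fin n)))
    (v : EuclideanSpace 𝕜 (Fin n)) : EuclideanSpace 𝕜 (Fin n) :=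
  Wᗮ.starProjection (Matrix.toEuclideanCLM (n := Fin n) (𝕜 := 𝕜) A v)

/-- The Lanczos vectors with starting vector `u`: `v₀ = u`, and `v_{j+1}` is the normalization of
`Proj_{W_jᗮ} (A v_j)`, where `W_j = span {v₀, …, v_j}`. If that projection vanishes, so that the
algorithm stops, all later vectors are `0` (as `0⁻¹ = 0`). -/
def lanczosVec (A : Matrix (Fin n) (Fin n) 𝕜) (u : EuclideanSpace 𝕜 (Fin n)) :
    ℕ → EuclideanSpace 𝕜 (Fin n)
  | 0 => u
  | j + 1 =>
    let r := residual A
      (Submodule.span 𝕜 (Set.range fun i : Fin (j + 1) => lanczosVec A u i)) (lanczosVec A u j)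
    ((‖r‖⁻¹ : ℝ) : 𝕜) • r
  termination_by j => j
  decreasing_by
    · exact i.isLt
    · exact Nat.lt_succ_self j

/-- `W_j = span {v₀, …, v_j}`. -/
def krylov (A : Matrix (Fin n) (Fin n) 𝕜) (u : EuclideanSpace 𝕜 (Fin n)) (j : ℕ) :
    Submodule 𝕜 (EuclideanSpace 𝕜 (Fin n)) :=
  Submodule.span 𝕜 (Set.range fun i : Fin (j + 1) => lanczosVec A u i)

/-- The Jacobi coefficient `α_j(u) = ⟨A v_j, v_j⟩` (a real number when `A` is Hermitian). -/
def alphaCoeff (A : Matrix (Fin n) (Fin n) 𝕜) (u : Sphere n) (j : ℕ) : ℝ :=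
  let v := lanczosVec A (toField 𝕜 (u : EuclideanSpace ℝ (Fin n))) j
  RCLike.re (inner 𝕜 (Matrix.toEuclideanCLM (n := Fin n) (𝕜 := 𝕜) A v) v)

/-- The Jacobi coefficient `β_j(u) = ‖Proj_{W_jᗮ} (A v_j)‖`. -/
def betaCoeff (A : Matrix (Fin n) (Fin n) 𝕜) (u : Sphere n) (j : ℕ) : ℝ :=
  let u' := toField 𝕜 (u : EuclideanSpace ℝ (Fin n))
  ‖residual A (krylov A u' j) (lanczosVec A u' j)‖

end Algorithm

/-- The `k × k` symmetric tridiagonal matrix with diagonal entries `a 0, …, a (k-1)` and with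
subdiagonal and superdiagonal entries `b 0, …, b (k-2)`. -/
def jacobiMatrix (k : ℕ) (a b : ℕ → ℝ) : Matrix (Fin k) (Fin k) ℝ :=
  Matrix.of fun i j =>
    if (i : ℕ) = j then a i
    else if (i : ℕ) + 1 = j then b i
    else if (j : ℕ) + 1 = i then b j
    else 0

theorem jacobiMatrix_isHermitian (k : ℕ) (a b : ℕ → ℝ) : (jacobiMatrix k a b).IsHermitian := by
  ext i j
  simp only [jacobiMatrix, Matrix.conjTranspose_apply, Matrix.of_apply, star_trivial]
  grind

/-- The eigenvalues of the `k × k` Jacobi matrix in decreasing order, with multiplicity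
(`i = 0` gives the largest one). -/
def ritzValue (k : ℕ) (a b : ℕ → ℝ) (i : Fin k) : ℝ :=
  (jacobiMatrix_isHermitian k a b).eigenvalues₀ (Fin.cast (Fintype.card_fin k).symm i)

/-- `w` is an eigenvector of the `k × k` Jacobi matrix for its `i`-th largest eigenvalue. -/
def IsRitzEigenvector (k : ℕ) (a b : ℕ → ℝ) (i : Fin k) (w : EuclideanSpace ℝ (Fin k)) : Prop :=
  Module.End.HasEigenvector (Matrix.toEuclideanLin (jacobiMatrix k a b)) (ritzValue k a b i) w

/-- The angle in `[0, π/2]` between the lines spanned by two nonzero vectors. -/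
def lineAngle {k : ℕ} (x y : EuclideanSpace ℝ (Fin k)) : ℝ :=
  min (InnerProductGeometry.angle x y) (Real.pi - InnerProductGeometry.angle x y)

end Lanczos

end

/-!
The coefficients `α_j`, `β_j` are Lipschitz functions of the starting vector on a set of nearly full
measure, so concentration of measure on the sphere keeps all entries of `J_k(u)` near their medians;
a Davis–Kahan estimate turns this into closeness of eigenvectors.

*Concentration.* If two subsets `B`, `C` of the sphere are at distance `t`, the midpoints between
the cones over them lie in a ball of radius `exp (-t² / 8)`. The Prékopa–Leindler inequality
(`lintegral_mul_lintegral_le_pi`) therefore gives `P(B) P(C) ≤ exp (-n t² / 4)`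
(`unifSphere_mul_unifSphere_le`). For a function that is Lipschitz only on a large subset, this
bounds the deviation from the median there (`unifSphere_abs_sub_median`). No measurability of the
coefficients is used.

*Lipschitz estimates.* Let `D_j = β_0 ⋯ β_{j-1}` (`betaProd`). By the three-term recurrence
`op_lanczosVec`, `D_j v_j = q(A) u` for a monic `q` of degree `j`, and `D_j` is the minimum of
`‖q(A) u‖` over such `q`. Moving the roots of `q` into `[-‖A‖, ‖A‖]` does not increase this norm, so
`‖q(A)‖ ≤ (2 ‖A‖) ^ j` may be assumed, and `D_j` is `(2 ‖A‖) ^ j`-Lipschitz. Hence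
`β_j = D_{j+1} / D_j` is Lipschitz where `D_j` is bounded below (`abs_beta_sub_mul_le`). For `α_j`, put
`w = D_j v_j` and `w'` likewise for a second starting vector. Then `⟨(A - α_j) w, w'⟩` is small by
orthogonality, and so is `⟨w, (A - α_j') w'⟩`; their difference is `(α_j' - α_j) ⟨w, w'⟩`
(`abs_alpha_sub_mul_le`).

*Lower bound for `D_{k-1}`.* For fixed distinct roots, equidistribution gives `δ n` eigenvectors on
which the polynomial is at least `ω ^ (k-1)`. A random vector has mass of order `δ` on them, except
with probability exponentially small in `δ n` (`unifSphere_sum_norm_inner_sq_lt`). A union bound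
over roots in a grid of `n` points covers all polynomials (`unifSphere_betaProd_lt`).

The resulting constants leave enough room that the second exponential of the bound suffices. When
`4 k` times it is at least `1` there is nothing to prove; otherwise `n` is so large that the union
bound is harmless, the medians of the `β_j` are positive, and the median matrix has simple spectrum,
so that `ε > 0`.
-/

noncomputable section

/-! ### The Prékopa–Leindler inequality at the midpoint -/

/-- The one-dimensional Brunn–Minkowski inequality for compact sets: the translates `A + min B` and
`max A + B` of `A` and `B` overlap in a single point. -/
theorem volume_add_volume_le_of_isCompact {A B C : Set ℝ} (hA : IsCompact A) (hB : IsCompact B)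
    (hA' : A.Nonempty) (hB' : B.Nonempty)
    (h : ∀ x ∈ A, ∀ y ∈ B, (x + y) / 2 ∈ C) :
    volume A + volume B ≤ 2 * volume C := by
  have ha := hA.sSup_mem hA'
  have hb := hB.sInf_mem hB'
  set a := sSup A
  set b := sInf B
  have hC : 2 * volume C = volume ((fun z : ℝ => z * (1 / 2)) ⁻¹' C) := by
    rw [Real.volume_preimage_mul_right (by norm_num)]
    norm_num
  have h1 : volume A = volume ((fun x : ℝ => x + (-b)) ⁻¹' A) :=
    (measure_preimage_add_right volume (-b) A).symm
  have h2 : volume B = volume ((fun x : ℝ => x + (-a)) ⁻¹' B) :=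
    (measure_preimage_add_right volume (-a) B).symm
  have hm : MeasurableSet ((fun x : ℝ => x + (-a)) ⁻¹' B) :=
    (measurable_add_const (-a)) hB.measurableSet
  rw [hC, h1, h2, ← measure_union₀ hm.nullMeasurableSet]
  · refine measure_mono ?_
    rintro z (hz | hz)
    · have := h _ hz _ hb
      simp only [Set.mem_preimage]
      convert this using 1
      ring
    · have := h _ ha _ hz
      simp only [Set.mem_preimage]
      convert this using 1
      ring
  · refine measure_mono_null (t := {a + b}) ?_ (by simp)
    rintro z ⟨hz1, hz2⟩
    have h3 : z + -b ≤ a := le_csSup hA.bddAbove hz1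
    have h4 : b ≤ z + -a := csInf_le hB.bddBelow hz2
    simp only [Set.mem_singleton_iff]
    linarith

theorem volume_add_volume_le {A B C : Set ℝ} (hA : MeasurableSet A) (hB : MeasurableSet B)
    (hA' : A.Nonempty) (hB' : B.Nonempty)
    (h : ∀ x ∈ A, ∀ y ∈ B, (x + y) / 2 ∈ C) :
    volume A + volume B ≤ 2 * volume C := by
  obtain ⟨a, ha⟩ := hA'
  obtain ⟨b, hb⟩ := hB'
  have key : ∀ K : {K : Set ℝ // K ⊆ A ∧ IsCompact K}, ∀ K' : {K : Set ℝ // K ⊆ B ∧ IsCompact K},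
      volume (K : Set ℝ) + volume (K' : Set ℝ) ≤ 2 * volume C := by
    rintro ⟨K, hK, hKc⟩ ⟨K', hK', hKc'⟩
    refine le_trans (add_le_add (measure_mono (Set.subset_insert a K))
      (measure_mono (Set.subset_insert b K'))) ?_
    refine volume_add_volume_le_of_isCompact (hKc.insert a) (hKc'.insert b)
      (Set.insert_nonempty _ _) (Set.insert_nonempty _ _) ?_
    intro x hx y hy
    exact h x (Set.insert_subset ha hK hx) y (Set.insert_subset hb hK' hy)
  have : Nonempty {K : Set ℝ // K ⊆ A ∧ IsCompact K} :=
    ⟨⟨∅, Set.empty_subset _, isCompact_empty⟩⟩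
  have : Nonempty {K : Set ℝ // K ⊆ B ∧ IsCompact K} :=
    ⟨⟨∅, Set.empty_subset _, isCompact_empty⟩⟩
  have e : ∀ S : Set ℝ, MeasurableSet S → volume S =
      ⨆ K : {K : Set ℝ // K ⊆ S ∧ IsCompact K}, volume (K : Set ℝ) := by
    intro S hS
    rw [hS.measure_eq_iSup_isCompact volume, iSup_subtype]
    simp_rw [iSup_and]
  rw [e A hA, e B hB]
  exact ENNReal.iSup_add_iSup_le key

/-- One-dimensional Prékopa–Leindler for functions with supremum `1`, by comparing level sets. -/
theorem lintegral_add_lintegral_le {f g h : ℝ → ENNReal} (hf : Measurable f) (hg : Measurable g)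
    (hh : Measurable h) (hf1 : ∀ x, f x ≤ 1) (hg1 : ∀ x, g x ≤ 1)
    (hf2 : ∀ s < 1, ∃ x, s < f x) (hg2 : ∀ s < 1, ∃ x, s < g x)
    (hfg : ∀ x y, f x * g y ≤ h ((x + y) / 2) ^ 2) :
    (∫⁻ x, f x) + (∫⁻ x, g x) ≤ 2 * ∫⁻ x, h x := by
  have layer : ∀ q : ℝ → ENNReal, Measurable q → (∀ x, q x ≤ 1) →
      ∫⁻ x, q x = ∫⁻ t in Set.Ioi (0 : ℝ), volume {x | ENNReal.ofReal t < q x} := by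
    intro q hq hq1
    have hfin : ∀ x, q x ≠ ⊤ := fun x => ((hq1 x).trans_lt ENNReal.one_lt_top).ne
    have := lintegral_eq_lintegral_meas_lt (f := fun x => (q x).toReal) volume
      (Filter.Eventually.of_forall fun x => ENNReal.toReal_nonneg) hq.ennreal_toReal.aemeasurable
    simp only [ENNReal.ofReal_toReal (hfin _)] at this
    rw [this]
    refine setLIntegral_congr_fun measurableSet_Ioi ?_
    intro t ht
    simp only
    congr 1
    ext x
    exact (ENNReal.ofReal_lt_iff_lt_toReal (le_of_lt ht) (hfin x)).symm
  have hh' : Measurable fun x => min (h x) 1 := hh.min measurable_const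
  calc (∫⁻ x, f x) + (∫⁻ x, g x)
      = ∫⁻ t in Set.Ioi (0 : ℝ), (volume {x | ENNReal.ofReal t < f x} +
          volume {x | ENNReal.ofReal t < g x}) := by
        rw [layer f hf hf1, layer g hg hg1, lintegral_add_left]
        refine Antitone.measurable ?_
        intro s t hst
        refine measure_mono fun x hx => ?_
        exact lt_of_le_of_lt (ENNReal.ofReal_le_ofReal hst) hx
    _ ≤ ∫⁻ t in Set.Ioi (0 : ℝ), 2 * volume {x | ENNReal.ofReal t < min (h x) 1} := by
        refine lintegral_mono fun t => ?_
        simp only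
        by_cases ht : ENNReal.ofReal t < 1
        · refine volume_add_volume_le (measurableSet_lt measurable_const hf)
            (measurableSet_lt measurable_const hg) (hf2 _ ht) (hg2 _ ht) ?_
          intro x hx y hy
          simp only [Set.mem_ofPred_eq] at hx hy ⊢
          refine lt_min ?_ ht
          by_contra hcon
          have h1 := hfg x y
          have h2 : h ((x + y) / 2) ^ 2 ≤ ENNReal.ofReal t ^ 2 := by gcongr; exact not_lt.1 hcon
          have h3 : ENNReal.ofReal t ^ 2 < f x * g y := by
            rw [sq]; exact ENNReal.mul_lt_mul hx hy
          exact absurd (h3.trans_le (h1.trans h2)) (lt_irrefl _)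
        · have e1 : {x | ENNReal.ofReal t < f x} = ∅ := by
            ext x; simpa using (hf1 x).trans (not_lt.1 ht)
          have e2 : {x | ENNReal.ofReal t < g x} = ∅ := by
            ext x; simpa using (hg1 x).trans (not_lt.1 ht)
          simp [e1, e2]
    _ = 2 * ∫⁻ x, min (h x) 1 := by
        rw [lintegral_const_mul' _ _ (by norm_num), layer _ hh' fun x => min_le_right _ _]
    _ ≤ 2 * ∫⁻ x, h x := by
        gcongr
        exact min_le_left _ _

theorem ENNReal.four_mul_le_add_sq (a b : ENNReal) : 4 * (a * b) ≤ (a + b) ^ 2 := by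
  rcases eq_or_ne a ⊤ with rfl | ha
  · simp
  rcases eq_or_ne b ⊤ with rfl | hb
  · simp
  lift a to NNReal using ha
  lift b to NNReal using hb
  have := four_mul_le_sq_add a b
  rw [mul_assoc] at this
  exact_mod_cast this

theorem lintegral_mul_lintegral_le_of_bounded {f g h : ℝ → ENNReal} (hf : Measurable f)
    (hg : Measurable g) (hh : Measurable h) {N : ENNReal} (hN : N ≠ ⊤) (hf1 : ∀ x, f x ≤ N)
    (hg1 : ∀ x, g x ≤ N) (hfg : ∀ x y, f x * g y ≤ h ((x + y) / 2) ^ 2) :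
    (∫⁻ x, f x) * (∫⁻ x, g x) ≤ (∫⁻ x, h x) ^ 2 := by
  set a := ⨆ x, f x with ha
  set b := ⨆ x, g x with hb
  have haN : a ≠ ⊤ := ((iSup_le hf1).trans_lt hN.lt_top).ne
  have hbN : b ≠ ⊤ := ((iSup_le hg1).trans_lt hN.lt_top).ne
  rcases eq_or_ne a 0 with ha0 | ha0
  · have : ∀ x, f x = 0 := fun x => le_antisymm (ha0 ▸ le_iSup f x) zero_le
    simp [this]
  rcases eq_or_ne b 0 with hb0 | hb0
  · have : ∀ x, g x = 0 := fun x => le_antisymm (hb0 ▸ le_iSup g x) zero_le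
    simp [this]
  -- normalize `f`, `g` to supremum `1` and `h` by the geometric mean of the two suprema
  set c := (a * b) ^ (1 / 2 : ℝ) with hc
  have hc2 : c ^ 2 = a * b := by
    rw [hc, ← ENNReal.rpow_natCast, ← ENNReal.rpow_mul]; norm_num
  have hc0 : c ≠ 0 := by
    intro h0; rw [h0] at hc2; simp [ha0, hb0] at hc2
  have hcT : c ≠ ⊤ := by
    intro h0; rw [h0] at hc2; simp at hc2; exact ENNReal.mul_ne_top haN hbN hc2.symm
  have key := lintegral_add_lintegral_le (f := fun x => a⁻¹ * f x) (g := fun x => b⁻¹ * g x)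
    (h := fun x => c⁻¹ * h x) (hf.const_mul _) (hg.const_mul _) (hh.const_mul _)
    (fun x => by
      rw [mul_comm, ← div_eq_mul_inv]
      exact ENNReal.div_le_of_le_mul (by simpa using le_iSup f x))
    (fun x => by
      rw [mul_comm, ← div_eq_mul_inv]
      exact ENNReal.div_le_of_le_mul (by simpa using le_iSup g x))
    (fun s hs => by
      have : s * a < a := by
        simpa using ENNReal.mul_lt_mul_left ha0 haN hs
      obtain ⟨x, hx⟩ := lt_iSup_iff.1 this
      exact ⟨x, by rw [mul_comm, ← div_eq_mul_inv]
                   exact (ENNReal.lt_div_iff_mul_lt (Or.inl ha0) (Or.inl haN)).2 hx⟩)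
    (fun s hs => by
      have : s * b < b := by
        simpa using ENNReal.mul_lt_mul_left hb0 hbN hs
      obtain ⟨x, hx⟩ := lt_iSup_iff.1 this
      exact ⟨x, by rw [mul_comm, ← div_eq_mul_inv]
                   exact (ENNReal.lt_div_iff_mul_lt (Or.inl hb0) (Or.inl hbN)).2 hx⟩)
    (fun x y => by
      have e : (c⁻¹) ^ 2 = a⁻¹ * b⁻¹ := by
        rw [← ENNReal.inv_pow, hc2, ENNReal.mul_inv (Or.inl ha0) (Or.inl haN)]
      rw [mul_pow, e, mul_mul_mul_comm]
      gcongr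
      exact hfg x y)
  rw [lintegral_const_mul _ hf, lintegral_const_mul _ hg, lintegral_const_mul _ hh] at key
  have h4 := (ENNReal.four_mul_le_add_sq _ _).trans (pow_le_pow_left' key 2)
  set F := ∫⁻ x, f x
  set G := ∫⁻ x, g x
  set H := ∫⁻ x, h x
  have e1 : (2 * (c⁻¹ * H)) ^ 2 = 4 * ((a * b)⁻¹ * H ^ 2) := by
    rw [mul_pow, mul_pow, ← ENNReal.inv_pow, hc2]; norm_num
  have e2 : 4 * (a⁻¹ * F * (b⁻¹ * G)) = 4 * ((a * b)⁻¹ * (F * G)) := by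
    rw [ENNReal.mul_inv (Or.inl ha0) (Or.inl haN)]; ring
  rw [e1, e2] at h4
  have h5 := (ENNReal.mul_le_mul_iff_right (a := 4) (by norm_num) (by norm_num)).1 h4
  exact (ENNReal.mul_le_mul_iff_right
    (ENNReal.inv_ne_zero.2 (ENNReal.mul_ne_top haN hbN))
    (ENNReal.inv_ne_top.2 (mul_ne_zero ha0 hb0))).1 h5

theorem lintegral_mul_lintegral_le_real {f g h : ℝ → ENNReal} (hf : Measurable f)
    (hg : Measurable g) (hh : Measurable h) (hfg : ∀ x y, f x * g y ≤ h ((x + y) / 2) ^ 2) :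
    (∫⁻ x, f x) * (∫⁻ x, g x) ≤ (∫⁻ x, h x) ^ 2 := by
  have trunc : ∀ q : ℝ → ENNReal, Measurable q →
      ∫⁻ x, q x = ⨆ N : ℕ, ∫⁻ x, min (q x) N := by
    intro q hq
    rw [← lintegral_iSup (fun N => hq.min measurable_const)]
    · congr with x
      refine le_antisymm ?_ (iSup_le fun N => min_le_left _ _)
      refine le_of_forall_lt fun s hs => ?_
      obtain ⟨N, hN⟩ := ENNReal.exists_nat_gt (hs.trans_le le_top).ne
      exact lt_iSup_iff.2 ⟨N, lt_min hs hN⟩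
    · intro N M hNM x
      exact min_le_min le_rfl (by exact_mod_cast hNM)
  rw [trunc f hf, trunc g hg]
  simp_rw [ENNReal.iSup_mul, ENNReal.mul_iSup]
  refine iSup_le fun N => iSup_le fun M => ?_
  refine lintegral_mul_lintegral_le_of_bounded (N := max (N : ENNReal) M)
    (hf.min measurable_const) (hg.min measurable_const) hh (by simp)
    (fun x => (min_le_right _ _).trans (le_max_left _ _))
    (fun x => (min_le_right _ _).trans (le_max_right _ _)) fun x y => le_trans ?_ (hfg x y)
  gcongr <;> exact min_le_left _ _

/-- The **Prékopa–Leindler inequality** at the midpoint, in squared form. -/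
theorem lintegral_mul_lintegral_le_pi : ∀ {n : ℕ} {f g h : (Fin n → ℝ) → ENNReal},
    Measurable f → Measurable g → Measurable h →
    (∀ x y, f x * g y ≤ h ((1 / 2 : ℝ) • (x + y)) ^ 2) →
    (∫⁻ x, f x) * (∫⁻ x, g x) ≤ (∫⁻ x, h x) ^ 2 := by
  intro n
  induction n with
  | zero =>
    intro f g h hf hg hh hfg
    have e : ∀ q : (Fin 0 → ℝ) → ENNReal, ∫⁻ x, q x = q 0 := by
      intro q
      have h0 : q = fun _ => q 0 := funext fun x => congrArg q (Subsingleton.elim x 0)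
      rw [h0, lintegral_const]
      simp [volume_pi]
    rw [e, e, e]
    simpa using hfg 0 0
  | succ n ih =>
    intro f g h hf hg hh hfg
    have mcons : Measurable fun p : ℝ × (Fin n → ℝ) =>
        (Fin.cons p.1 p.2 : Fin (n + 1) → ℝ) := by
      have := (MeasurableEquiv.piFinSuccAbove (fun _ : Fin (n + 1) => ℝ) 0).symm.measurable
      simpa [MeasurableEquiv.piFinSuccAbove_symm_apply, Fin.consEquiv] using! this
    have fub : ∀ q : (Fin (n + 1) → ℝ) → ENNReal, Measurable q →
        ∫⁻ x, q x = ∫⁻ s : ℝ, ∫⁻ y : Fin n → ℝ, q (Fin.cons s y) := by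
      intro q hq
      have hp := (volume_preserving_piFinSuccAbove (fun _ : Fin (n + 1) => ℝ) 0).symm
      rw [← hp.lintegral_comp hq, Measure.volume_eq_prod, lintegral_prod]
      · simp [MeasurableEquiv.piFinSuccAbove_symm_apply, Fin.consEquiv]
      · exact (hq.comp (MeasurableEquiv.measurable _)).aemeasurable
    have slice : ∀ (q : (Fin (n + 1) → ℝ) → ENNReal), Measurable q → ∀ s : ℝ,
        Measurable fun y : Fin n → ℝ => q (Fin.cons s y) := fun q hq s =>
      hq.comp (mcons.comp measurable_prodMk_left)
    have outer : ∀ (q : (Fin (n + 1) → ℝ) → ENNReal), Measurable q →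
        Measurable fun s : ℝ => ∫⁻ y : Fin n → ℝ, q (Fin.cons s y) := fun q hq =>
      (hq.comp mcons).lintegral_prod_right'
    rw [fub f hf, fub g hg, fub h hh]
    refine lintegral_mul_lintegral_le_real (outer f hf) (outer g hg) (outer h hh) fun s t => ?_
    refine ih (slice f hf s) (slice g hg t) (slice h hh _) fun x y => ?_
    refine (hfg (Fin.cons s x) (Fin.cons t y)).trans (le_of_eq ?_)
    congr 2
    funext i
    refine Fin.cases ?_ (fun j => ?_) i
    · simp; ring
    · simp [mul_add]

/-! ### Concentration of measure on the sphere -/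

open scoped Pointwise

/-- The multiplicative Brunn–Minkowski inequality for midpoints. -/
theorem volume_mul_volume_le_sq {n : ℕ} {A B C : Set (EuclideanSpace ℝ (Fin n))}
    (hA : MeasurableSet A) (hB : MeasurableSet B) (hC : MeasurableSet C)
    (h : ∀ x ∈ A, ∀ y ∈ B, (1 / 2 : ℝ) • (x + y) ∈ C) :
    volume A * volume B ≤ volume C ^ 2 := by
  have mp := PiLp.volume_preserving_toLp (Fin n)
  rw [← mp.measure_preimage hA.nullMeasurableSet, ← mp.measure_preimage hB.nullMeasurableSet,
    ← mp.measure_preimage hC.nullMeasurableSet]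
  have hA' := mp.measurable hA
  have hB' := mp.measurable hB
  have hC' := mp.measurable hC
  rw [← lintegral_indicator_one hA', ← lintegral_indicator_one hB', ← lintegral_indicator_one hC']
  refine lintegral_mul_lintegral_le_pi (measurable_one.indicator hA')
    (measurable_one.indicator hB') (measurable_one.indicator hC') fun x y => ?_
  by_cases hx : WithLp.toLp 2 x ∈ A
  · by_cases hy : WithLp.toLp 2 y ∈ B
    · have hz : WithLp.toLp 2 ((1 / 2 : ℝ) • (x + y)) ∈ C := h _ hx _ hy
      rw [Set.indicator_of_mem (by exact hx), Set.indicator_of_mem (by exact hy),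
        Set.indicator_of_mem (by exact hz)]
      simp
    · rw [Set.indicator_of_notMem (s := _ ⁻¹' B) (by exact hy)]
      simp
  · rw [Set.indicator_of_notMem (s := _ ⁻¹' A) (by exact hx)]
    simp

theorem measurableSet_Ioo_smul_sphere {n : ℕ} {s : Set (Lanczos.Sphere n)}
    (hs : MeasurableSet s) :
    MeasurableSet (Set.Ioo (0 : ℝ) 1 • ((↑) '' s : Set (EuclideanSpace ℝ (Fin n)))) := by
  have e : ((↑) '' (homeomorphUnitSphereProd (EuclideanSpace ℝ (Fin n)) ⁻¹'
      s ×ˢ Set.Iio (⟨1, Set.mem_Ioi.2 one_pos⟩ : Set.Ioi (0 : ℝ)))) =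
      (Set.Ioo (0 : ℝ) 1 • ((↑) '' s : Set (EuclideanSpace ℝ (Fin n)))) := by
    rw [← Set.image2_smul, Set.image2_image_right, ← Homeomorph.image_symm, Set.image_image,
      ← Set.image_subtype_val_Ioi_Iio (⟨1, Set.mem_Ioi.2 one_pos⟩ : Set.Ioi (0 : ℝ)),
      Set.image2_image_left, Set.image2_swap, ← Set.image_prod]
    rfl
  rw [← e]
  exact (MeasurableEmbedding.subtype_coe (measurableSet_singleton _).compl).measurableSet_image.2
    ((Homeomorph.measurable _) (hs.prod measurableSet_Iio))

/-- Midpoints of radial segments over two points of the sphere at distance at least `t` lie in a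
ball of radius `exp (-t² / 8)`. -/
theorem norm_midpoint_smul_le {E : Type*} [NormedAddCommGroup E] [InnerProductSpace ℝ E]
    {a b : E} (ha : ‖a‖ = 1) (hb : ‖b‖ = 1) {t : ℝ} (ht : 0 ≤ t) (hab : t ≤ ‖a - b‖)
    {r s : ℝ} (hr : r ∈ Set.Ioo (0 : ℝ) 1) (hs : s ∈ Set.Ioo (0 : ℝ) 1) :
    ‖(1 / 2 : ℝ) • (r • a + s • b)‖ ≤ Real.exp (-(t ^ 2 / 8)) := by
  obtain ⟨hr0, hr1⟩ := hr
  obtain ⟨hs0, hs1⟩ := hs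
  set p : ℝ := inner ℝ a b with hp
  have e1 : ‖a - b‖ ^ 2 = 2 - 2 * p := by rw [norm_sub_sq_real, ha, hb, ← hp]; ring
  have e2 : ‖r • a + s • b‖ ^ 2 = r ^ 2 + s ^ 2 + 2 * r * s * p := by
    rw [norm_add_sq_real, inner_smul_left, inner_smul_right, norm_smul, norm_smul, ha, hb, ← hp]
    simp
    ring
  have ht2 : t ^ 2 ≤ 2 - 2 * p := by rw [← e1]; gcongr
  have ht4 : t ^ 2 ≤ 4 := by
    have : ‖a - b‖ ≤ 2 := by
      calc ‖a - b‖ ≤ ‖a‖ + ‖b‖ := norm_sub_le _ _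
        _ = 2 := by rw [ha, hb]; norm_num
    nlinarith [norm_nonneg (a - b)]
  have x1 : 1 - t ^ 2 / 4 ≤ Real.exp (-(t ^ 2 / 4)) := by
    have := Real.add_one_le_exp (-(t ^ 2 / 4)); linarith
  have x2 : 1 / 4 ≤ Real.exp (-(t ^ 2 / 4)) := by
    have h1 : Real.exp (-1) ≤ Real.exp (-(t ^ 2 / 4)) := Real.exp_le_exp.2 (by linarith)
    have h2 : (0.25 : ℝ) ≤ Real.exp (-1) := by
      linarith [Real.exp_neg_one_gt_d9]
    linarith
  -- a convex function of `(r, s)` is largest at the corners of the square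
  have key : r ^ 2 + s ^ 2 + 2 * r * s * p ≤ max 1 (2 + 2 * p) := by
    have hrs : 0 < r * s := mul_pos hr0 hs0
    have hrs1 : r * s ≤ 1 := by nlinarith
    have h1 : r ^ 2 + s ^ 2 ≤ 1 + r * s := by
      rcases le_total r s with h | h <;> nlinarith
    rcases le_total 0 (1 + 2 * p) with h | h
    · exact le_max_of_le_right (by nlinarith)
    · exact le_max_of_le_left (by nlinarith)
  have e3 : ‖(1 / 2 : ℝ) • (r • a + s • b)‖ ^ 2 ≤ Real.exp (-(t ^ 2 / 8)) ^ 2 := by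
    rw [norm_smul, mul_pow, e2, ← Real.exp_nat_mul]
    have : ((2 : ℕ) : ℝ) * -(t ^ 2 / 8) = -(t ^ 2 / 4) := by push_cast; ring
    rw [this]
    have h2 : max 1 (2 + 2 * p) ≤ 4 * Real.exp (-(t ^ 2 / 4)) :=
      max_le (by linarith) (by linarith)
    norm_num
    linarith
  exact (sq_le_sq₀ (norm_nonneg _) (Real.exp_pos _).le).1 e3

namespace Lanczos

theorem unifSphere_apply {n : ℕ} (hn : n ≠ 0) {s : Set (Sphere n)} (hs : MeasurableSet s) :
    unifSphere n s = volume (Set.Ioo (0 : ℝ) 1 • ((↑) '' s : Set (EuclideanSpace ℝ (Fin n)))) /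
      volume (Metric.ball (0 : EuclideanSpace ℝ (Fin n)) 1) := by
  rw [unifSphere, Measure.smul_apply, Measure.toSphere_apply_univ, Measure.toSphere_apply' _ hs,
    finrank_euclideanSpace_fin, smul_eq_mul, mul_comm, ← div_eq_mul_inv,
    ENNReal.mul_div_mul_left _ _ (by simpa using hn) (by simp)]

theorem isProbabilityMeasure_unifSphere {n : ℕ} (hn : n ≠ 0) :
    IsProbabilityMeasure (unifSphere n) := by
  have : Nonempty (Fin n) := Fin.pos_iff_nonempty.1 (Nat.pos_of_ne_zero hn)
  constructor
  rw [unifSphere, Measure.smul_apply, smul_eq_mul]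
  refine ENNReal.inv_mul_cancel ?_ (measure_ne_top _ _)
  simpa using And.intro hn (Metric.measure_ball_pos volume (0 : EuclideanSpace ℝ (Fin n)) one_pos).ne'

theorem isEmpty_sphere_zero : IsEmpty (Sphere 0) := by
  refine ⟨fun u => ?_⟩
  have h1 := mem_sphere_zero_iff_norm.1 u.2
  rw [Subsingleton.elim (u : EuclideanSpace ℝ (Fin 0)) 0, norm_zero] at h1
  exact zero_ne_one h1

instance isFiniteMeasure_unifSphere {n : ℕ} : IsFiniteMeasure (unifSphere n) := by
  rcases eq_or_ne n 0 with rfl | hn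
  · have := isEmpty_sphere_zero
    exact ⟨by rw [Set.univ_eq_empty_iff.2 this]; simp⟩
  · have := isProbabilityMeasure_unifSphere hn
    infer_instance

theorem unifSphere_real_le_one {n : ℕ} (s : Set (Sphere n)) : (unifSphere n).real s ≤ 1 := by
  rcases eq_or_ne n 0 with rfl | hn
  · have := isEmpty_sphere_zero
    rw [Set.eq_empty_of_isEmpty s]
    simp
  · have := isProbabilityMeasure_unifSphere hn
    exact measureReal_le_one

/-- Two subsets of the sphere at distance `t` cannot both be large. Arbitrary sets are allowed:
the measure of a non-measurable set is its outer measure. -/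
theorem unifSphere_mul_unifSphere_le {n : ℕ} (hn : n ≠ 0) {B C : Set (Sphere n)} {t : ℝ}
    (ht : 0 ≤ t) (h : ∀ x ∈ B, ∀ y ∈ C, t ≤ dist x y) :
    (unifSphere n).real B * (unifSphere n).real C ≤ Real.exp (-(n * t ^ 2 / 4)) := by
  have : Nonempty (Fin n) := Fin.pos_iff_nonempty.1 (Nat.pos_of_ne_zero hn)
  have hcl : ∀ x ∈ closure B, ∀ y ∈ closure C, t ≤ dist x y := by
    intro x hx y hy
    have hcl : IsClosed {p : Sphere n × Sphere n | t ≤ dist p.1 p.2} :=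
      isClosed_le continuous_const (continuous_fst.dist continuous_snd)
    have hsub : B ×ˢ C ⊆ {p : Sphere n × Sphere n | t ≤ dist p.1 p.2} := fun p hp =>
      h _ hp.1 _ hp.2
    have hxy : (x, y) ∈ closure (B ×ˢ C) := by
      rw [closure_prod_eq]
      exact ⟨hx, hy⟩
    have h3 : (x, y) ∈ {p : Sphere n × Sphere n | t ≤ dist p.1 p.2} := closure_minimal hsub hcl hxy
    exact h3
  have mB : MeasurableSet (closure B) := isClosed_closure.measurableSet
  have mC : MeasurableSet (closure C) := isClosed_closure.measurableSet
  have hvol := volume_mul_volume_le_sq (measurableSet_Ioo_smul_sphere mB)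
    (measurableSet_Ioo_smul_sphere mC)
    (measurableSet_closedBall (x := (0 : EuclideanSpace ℝ (Fin n))) (ε := Real.exp (-(t ^ 2 / 8))))
    (by
      rintro _ ⟨r, hr, _, ⟨a, ha, rfl⟩, rfl⟩ _ ⟨s, hs, _, ⟨b, hb, rfl⟩, rfl⟩
      rw [mem_closedBall_zero_iff]
      refine norm_midpoint_smul_le (mem_sphere_zero_iff_norm.1 a.2)
        (mem_sphere_zero_iff_norm.1 b.2) ht ?_ hr hs
      have := hcl a ha b hb
      rwa [Subtype.dist_eq, dist_eq_norm] at this)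
  rw [Measure.addHaar_closedBall _ _ (Real.exp_pos _).le, finrank_euclideanSpace_fin] at hvol
  set V := volume (Metric.ball (0 : EuclideanSpace ℝ (Fin n)) 1) with hV
  have hV0 : V ≠ 0 := (Metric.measure_ball_pos _ _ one_pos).ne'
  have hVT : V ≠ ⊤ := measure_ball_lt_top.ne
  have hmain : unifSphere n (closure B) * unifSphere n (closure C) ≤
      ENNReal.ofReal (Real.exp (-(n * t ^ 2 / 4))) := by
    rw [unifSphere_apply hn mB, unifSphere_apply hn mC, ← hV, div_eq_mul_inv, div_eq_mul_inv,
      mul_mul_mul_comm]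
    have e : ENNReal.ofReal (Real.exp (-(t ^ 2 / 8)) ^ n) ^ 2 =
        ENNReal.ofReal (Real.exp (-(n * t ^ 2 / 4))) := by
      rw [← ENNReal.ofReal_pow (by positivity), ← pow_mul, ← Real.exp_nat_mul]
      congr 2
      push_cast
      ring
    calc _ ≤ (ENNReal.ofReal (Real.exp (-(t ^ 2 / 8)) ^ n) * V) ^ 2 * (V⁻¹ * V⁻¹) := by gcongr
      _ = ENNReal.ofReal (Real.exp (-(t ^ 2 / 8)) ^ n) ^ 2 * ((V * V⁻¹) * (V * V⁻¹)) := by ring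
      _ = _ := by rw [ENNReal.mul_inv_cancel hV0 hVT, e]; simp
  calc (unifSphere n).real B * (unifSphere n).real C
      ≤ (unifSphere n).real (closure B) * (unifSphere n).real (closure C) := by
        gcongr <;> first | exact measure_ne_top _ _ | exact subset_closure
    _ ≤ _ := by
        rw [Measure.real, Measure.real, ← ENNReal.toReal_mul]
        exact ENNReal.toReal_le_of_le_ofReal (Real.exp_pos _).le hmain

end Lanczos

/-! ### Perturbation of eigenvalues and eigenvectors -/

namespace LinearMap.IsSymmetric

variable {E : Type*} [NormedAddCommGroup E] [InnerProductSpace ℝ E] [FiniteDimensional ℝ E]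
  {n : ℕ}

theorem inner_eigenvectorBasis_apply {T : E →ₗ[ℝ] E} (hT : T.IsSymmetric)
    (hn : Module.finrank ℝ E = n) (j : Fin n) (x : E) :
    inner ℝ (hT.eigenvectorBasis hn j) (T x) =
      hT.eigenvalues hn j * inner ℝ (hT.eigenvectorBasis hn j) x := by
  rw [← hT, hT.apply_eigenvectorBasis, inner_smul_left]
  simp

theorem inner_apply_self_eq_sum {T : E →ₗ[ℝ] E} (hT : T.IsSymmetric)
    (hn : Module.finrank ℝ E = n) (x : E) :
    inner ℝ x (T x) =
      ∑ j, hT.eigenvalues hn j * inner ℝ (hT.eigenvectorBasis hn j) x ^ 2 := by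
  rw [← (hT.eigenvectorBasis hn).sum_inner_mul_inner]
  refine Finset.sum_congr rfl fun j _ => ?_
  rw [inner_eigenvectorBasis_apply, real_inner_comm]
  ring

theorem sum_inner_eigenvectorBasis_sq {T : E →ₗ[ℝ] E} (hT : T.IsSymmetric)
    (hn : Module.finrank ℝ E = n) (x : E) :
    ∑ j, inner ℝ (hT.eigenvectorBasis hn j) x ^ 2 = ‖x‖ ^ 2 := by
  rw [← (hT.eigenvectorBasis hn).sum_sq_norm_inner_right x]
  simp

/-- **Weyl's inequality**: a nonzero combination of the top `i + 1` eigenvectors of `T` that is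
orthogonal to the top `i` eigenvectors of `S` compares the two Rayleigh quotients. -/
theorem eigenvalues_le_add {S T : E →ₗ[ℝ] E} (hS : S.IsSymmetric) (hT : T.IsSymmetric)
    (hn : Module.finrank ℝ E = n) {s : ℝ} (hs : ∀ x, ‖T x - S x‖ ≤ s * ‖x‖) (i : Fin n) :
    hT.eigenvalues hn i ≤ hS.eigenvalues hn i + s := by
  set e := hT.eigenvectorBasis hn
  set f := hS.eigenvectorBasis hn
  let emb : Fin (i + 1) → Fin n := fun j => ⟨j, by omega⟩
  let ψ : (Fin (i + 1) → ℝ) →ₗ[ℝ] E := Fintype.linearCombination ℝ fun j => e (emb j)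
  let φ : (Fin (i + 1) → ℝ) →ₗ[ℝ] (Fin i → ℝ) :=
    LinearMap.pi fun l => (innerₛₗ ℝ (f ⟨l, by omega⟩)).comp ψ
  have hker : LinearMap.ker φ ≠ ⊥ := LinearMap.ker_ne_bot_of_finrank_lt (by simp)
  obtain ⟨c, hc, hc0⟩ := (Submodule.ne_bot_iff _).1 hker
  set x := ψ c with hx
  have hemb : Function.Injective emb := fun a b h => by
    simpa [emb, Fin.ext_iff] using h
  have hx0 : x ≠ 0 := by
    intro h0
    have hli : LinearIndependent ℝ fun j => e (emb j) :=
      e.orthonormal.linearIndependent.comp emb hemb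
    apply hc0
    have := Fintype.linearIndependent_iff.1 hli c (by rw [← Fintype.linearCombination_apply]; exact h0)
    exact funext this
  have h1 : ∀ j : Fin n, i < j → inner ℝ (e j) x = 0 := by
    intro j hj
    simp only [hx, ψ, Fintype.linearCombination_apply, inner_sum, inner_smul_right]
    refine Finset.sum_eq_zero fun l _ => ?_
    have hne : j ≠ emb l := by
      intro h
      have h1 := congrArg Fin.val h
      have h2 := l.2
      simp only [emb] at h1
      have h3 : (i : ℕ) < j := hj
      omega
    rw [e.inner_eq_zero hne, mul_zero]
  have h2 : ∀ j : Fin n, j < i → inner ℝ (f j) x = 0 := by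
    intro j hj
    have := congrFun (LinearMap.mem_ker.1 hc) ⟨j, hj⟩
    simpa [φ] using this
  have hxpos : 0 < ‖x‖ ^ 2 := by positivity
  have h3 : hT.eigenvalues hn i * ‖x‖ ^ 2 ≤ inner ℝ x (T x) := by
    rw [inner_apply_self_eq_sum hT hn, ← sum_inner_eigenvectorBasis_sq hT hn, Finset.mul_sum]
    refine Finset.sum_le_sum fun j _ => ?_
    rcases le_or_gt j i with h | h
    · exact mul_le_mul_of_nonneg_right (hT.eigenvalues_antitone hn h) (sq_nonneg _)
    · simp [e, h1 j h] 
  have h4 : inner ℝ x (S x) ≤ hS.eigenvalues hn i * ‖x‖ ^ 2 := by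
    rw [inner_apply_self_eq_sum hS hn, ← sum_inner_eigenvectorBasis_sq hS hn, Finset.mul_sum]
    refine Finset.sum_le_sum fun j _ => ?_
    rcases le_or_gt i j with h | h
    · exact mul_le_mul_of_nonneg_right (hS.eigenvalues_antitone hn h) (sq_nonneg _)
    · simp [f, h2 j h]
  have h5 : inner ℝ x (T x) - inner ℝ x (S x) ≤ s * ‖x‖ ^ 2 := by
    rw [← inner_sub_right]
    calc _ ≤ ‖x‖ * ‖T x - S x‖ := real_inner_le_norm _ _
      _ ≤ ‖x‖ * (s * ‖x‖) := by gcongr; exact hs x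
      _ = _ := by ring
  nlinarith

theorem abs_eigenvalues_sub_le {S T : E →ₗ[ℝ] E} (hS : S.IsSymmetric) (hT : T.IsSymmetric)
    (hn : Module.finrank ℝ E = n) {s : ℝ} (hs : ∀ x, ‖T x - S x‖ ≤ s * ‖x‖) (i : Fin n) :
    |hT.eigenvalues hn i - hS.eigenvalues hn i| ≤ s := by
  rw [abs_le]
  constructor
  · have := eigenvalues_le_add hT hS hn (s := s)
      (fun x => by rw [norm_sub_rev]; exact hs x) i
    linarith
  · have := eigenvalues_le_add hS hT hn hs i
    linarith

/-- A form of the **Davis–Kahan theorem** in which only the spectrum of one of the two operators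
has to have a gap. -/
theorem mul_sin_angle_le {S T : E →ₗ[ℝ] E} (hS : S.IsSymmetric) (hT : T.IsSymmetric)
    (hn : Module.finrank ℝ E = n) {s : ℝ} (hs : ∀ x, ‖T x - S x‖ ≤ s * ‖x‖) (i : Fin n)
    {ε : ℝ} (hε : 0 < ε)
    (hgap : ∀ j, j ≠ i → ε ≤ |hT.eigenvalues hn i - hT.eigenvalues hn j|)
    {w v : E} (hw0 : w ≠ 0) (hv0 : v ≠ 0) (hw : S w = hS.eigenvalues hn i • w)
    (hv : T v = hT.eigenvalues hn i • v) :
    ε * Real.sin (InnerProductGeometry.angle w v) ≤ 2 * s := by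
  set e := hT.eigenvectorBasis hn with he
  set r := hT.eigenvalues hn with hr
  have hwpos : 0 < ‖w‖ := norm_pos_iff.2 hw0
  have hvpos : 0 < ‖v‖ := norm_pos_iff.2 hv0
  have hs0 : 0 ≤ s := by
    have := (norm_nonneg _).trans (hs w)
    exact nonneg_of_mul_nonneg_left this hwpos
  have hres : ‖T w - r i • w‖ ≤ 2 * s * ‖w‖ := by
    have e1 : T w - r i • w = (T w - S w) + (hS.eigenvalues hn i - r i) • w := by
      rw [sub_smul, ← hw]; abel
    rw [e1]
    calc _ ≤ ‖T w - S w‖ + ‖(hS.eigenvalues hn i - r i) • w‖ := norm_add_le _ _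
      _ ≤ s * ‖w‖ + s * ‖w‖ := by
        rw [norm_smul, Real.norm_eq_abs, abs_sub_comm]
        gcongr
        · exact hs w
        · exact abs_eigenvalues_sub_le hS hT hn hs i
      _ = _ := by ring
  have hlow : ε ^ 2 * (‖w‖ ^ 2 - inner ℝ (e i) w ^ 2) ≤ ‖T w - r i • w‖ ^ 2 := by
    rw [← sum_inner_eigenvectorBasis_sq hT hn (T w - r i • w),
      ← sum_inner_eigenvectorBasis_sq hT hn w,
      ← Finset.sum_erase_add _ _ (Finset.mem_univ i), ← he, add_sub_cancel_right, Finset.mul_sum]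
    refine le_trans (Finset.sum_le_sum ?_)
      (Finset.sum_le_univ_sum_of_nonneg (s := Finset.univ.erase i) fun j => sq_nonneg _)
    intro j hj
    have hji := Finset.ne_of_mem_erase hj
    have e2 : inner ℝ (e j) (T w - r i • w) = (r j - r i) * inner ℝ (e j) w := by
      rw [inner_sub_right, inner_smul_right, inner_eigenvectorBasis_apply]; ring
    rw [e2, mul_pow]
    refine mul_le_mul_of_nonneg_right ?_ (sq_nonneg _)
    rw [← sq_abs (r j - r i), abs_sub_comm]
    have := hgap j hji
    gcongr
  have hvj : ∀ j, j ≠ i → inner ℝ (e j) v = 0 := by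
    intro j hj
    have h1 := inner_eigenvectorBasis_apply hT hn j v
    rw [hv, inner_smul_right, ← he, ← hr] at h1
    have h2 : r i - r j ≠ 0 := by
      intro h0
      have := hgap j hj
      rw [h0, abs_zero] at this
      linarith
    have h3 : (r i - r j) * inner ℝ (e j) v = 0 := by linarith
    exact (mul_eq_zero.1 h3).resolve_left h2
  have hv2 : ‖v‖ ^ 2 = inner ℝ (e i) v ^ 2 := by
    rw [← sum_inner_eigenvectorBasis_sq hT hn v]
    exact Finset.sum_eq_single i (fun j _ hj => by rw [← he, hvj j hj]; simp) (by simp)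
  have hwv : inner ℝ w v = inner ℝ (e i) w * inner ℝ (e i) v := by
    rw [← e.sum_inner_mul_inner, Finset.sum_eq_single i (fun j _ hj => by rw [hvj j hj]; simp)
      (by simp), real_inner_comm]
  have hsin : (Real.sin (InnerProductGeometry.angle w v) * (‖w‖ * ‖v‖)) ^ 2 =
      ‖v‖ ^ 2 * (‖w‖ ^ 2 - inner ℝ (e i) w ^ 2) := by
    rw [InnerProductGeometry.sin_angle_mul_norm_mul_norm, Real.sq_sqrt
      (by nlinarith [real_inner_mul_inner_self_le w v]), real_inner_self_eq_norm_sq,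
      real_inner_self_eq_norm_sq, hwv]
    rw [hv2]
    ring
  have hfin : (ε * Real.sin (InnerProductGeometry.angle w v) * (‖w‖ * ‖v‖)) ^ 2 ≤
      (2 * s * (‖w‖ * ‖v‖)) ^ 2 := by
    rw [mul_assoc ε, mul_pow, hsin]
    have h6 : ‖T w - r i • w‖ ^ 2 ≤ (2 * s * ‖w‖) ^ 2 := by gcongr
    calc ε ^ 2 * (‖v‖ ^ 2 * (‖w‖ ^ 2 - inner ℝ (e i) w ^ 2))
        = ‖v‖ ^ 2 * (ε ^ 2 * (‖w‖ ^ 2 - inner ℝ (e i) w ^ 2)) := by ring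
      _ ≤ ‖v‖ ^ 2 * (2 * s * ‖w‖) ^ 2 := by gcongr; exact hlow.trans h6
      _ = _ := by ring
  have h7 := (abs_le_of_sq_le_sq' hfin (by positivity)).2
  exact le_of_mul_le_mul_right h7 (by positivity)

end LinearMap.IsSymmetric

/-! ### Jacobi matrices -/

namespace Lanczos

/-- The Schur test for symmetric matrices. -/
theorem norm_toEuclideanLin_le {k : ℕ} {M : Matrix (Fin k) (Fin k) ℝ} (hM : M.IsHermitian)
    {s : ℝ} (hs0 : 0 ≤ s) (hs : ∀ i, ∑ j, |M i j| ≤ s) (x : EuclideanSpace ℝ (Fin k)) :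
    ‖Matrix.toEuclideanLin M x‖ ≤ s * ‖x‖ := by
  refine abs_le_of_sq_le_sq' ?_ (by positivity) |>.2
  rw [mul_pow, EuclideanSpace.norm_sq_eq, EuclideanSpace.norm_sq_eq]
  have hcol : ∀ j, ∑ i, |M i j| ≤ s := fun j => by
    refine le_trans (le_of_eq (Finset.sum_congr rfl fun i _ => ?_)) (hs j)
    rw [← hM.apply i j]
    simp
  have hrow : ∀ i, ‖(Matrix.toEuclideanLin M x) i‖ ^ 2 ≤ s * ∑ j, |M i j| * ‖x j‖ ^ 2 := by
    intro i
    have e1 : (Matrix.toEuclideanLin M x) i = ∑ j, M i j * x j := rfl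
    have h1 : ‖(Matrix.toEuclideanLin M x) i‖ ≤ ∑ j, |M i j| * ‖x j‖ := by
      rw [e1]
      refine (norm_sum_le _ _).trans (le_of_eq ?_)
      simp
    calc _ ≤ (∑ j, |M i j| * ‖x j‖) ^ 2 := by gcongr
      _ ≤ (∑ j, |M i j|) * ∑ j, |M i j| * ‖x j‖ ^ 2 := by
        refine Finset.sum_sq_le_sum_mul_sum_of_sq_le_mul _ (fun j _ => abs_nonneg _)
          (fun j _ => by positivity) fun j _ => le_of_eq (by ring)
      _ ≤ _ := by
        refine mul_le_mul_of_nonneg_right (hs i) (Finset.sum_nonneg fun j _ => by positivity)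
  calc _ ≤ ∑ i, s * ∑ j, |M i j| * ‖x j‖ ^ 2 := Finset.sum_le_sum fun i _ => hrow i
    _ = s * ∑ j, (∑ i, |M i j|) * ‖x j‖ ^ 2 := by
      rw [← Finset.mul_sum, Finset.sum_comm]
      simp_rw [Finset.sum_mul]
    _ ≤ s * ∑ j, s * ‖x j‖ ^ 2 := by
      gcongr with j
      exact hcol j
    _ = _ := by rw [← Finset.mul_sum]; ring

theorem sum_abs_jacobiMatrix_sub_le {k : ℕ} {a b a' b' : ℕ → ℝ} {s t : ℝ} (ht : 0 ≤ t)
    (ha : ∀ j < k, |a j - a' j| ≤ s) (hb : ∀ j, j + 1 < k → |b j - b' j| ≤ t) (i : Fin k) :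
    ∑ j, |(jacobiMatrix k a b - jacobiMatrix k a' b') i j| ≤ s + t + t := by
  have hs : 0 ≤ s := (abs_nonneg _).trans (ha i i.2)
  have h1 : ∀ j : Fin k, |(jacobiMatrix k a b - jacobiMatrix k a' b') i j| ≤
      (if i = j then s else 0) + (if (i : ℕ) + 1 = j then t else 0) +
        (if (j : ℕ) + 1 = i then t else 0) := by
    intro j
    have hi := i.2
    have hj := j.2
    simp only [jacobiMatrix, Matrix.sub_apply, Matrix.of_apply, Fin.ext_iff]
    split_ifs with h1 h2 h3 <;> first | omega | skip
    · simpa using ha i hi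
    · simpa using hb i (by omega)
    · simpa using hb j (by omega)
    · simp
  have h2 : ∀ p : Fin k → Prop, [DecidablePred p] → (∀ x y, p x → p y → x = y) →
      ∑ j, (if p j then t else 0) ≤ t := by
    intro p _ hp
    by_cases h : ∃ x, p x
    · obtain ⟨x, hx⟩ := h
      rw [Finset.sum_eq_single x (fun y _ hy => if_neg fun hpy => hy (hp y x hpy hx)) (by simp),
        if_pos hx]
    · rw [Finset.sum_eq_zero fun y _ => if_neg fun hpy => h ⟨y, hpy⟩]
      exact ht
  refine (Finset.sum_le_sum fun j _ => h1 j).trans ?_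
  rw [Finset.sum_add_distrib, Finset.sum_add_distrib]
  refine add_le_add (add_le_add (by simp) (h2 _ fun x y hx hy => Fin.ext (by omega)))
    (h2 _ fun x y hx hy => Fin.ext (by omega))

/-- If the off-diagonal entries do not vanish, an eigenvector is determined by its first entry. -/
theorem eq_zero_of_jacobiMatrix_eigenvector {k : ℕ} {a b : ℕ → ℝ}
    (hb : ∀ j, j + 1 < k → b j ≠ 0) {r : ℝ} {x : EuclideanSpace ℝ (Fin k)}
    (hx : Matrix.toEuclideanLin (jacobiMatrix k a b) x = r • x)
    (h0 : ∀ j : Fin k, (j : ℕ) = 0 → x j = 0) : x = 0 := by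
  have key : ∀ m : ℕ, ∀ j : Fin k, (j : ℕ) ≤ m → x j = 0 := by
    intro m
    induction m with
    | zero => intro j hj; exact h0 j (by omega)
    | succ m ih =>
      intro j hj
      rcases Nat.lt_or_ge m j with hjm | hjm
      · have hjk := j.2
        have e := congrArg (fun v : EuclideanSpace ℝ (Fin k) => v ⟨m, by omega⟩) hx
        have e1 : (Matrix.toEuclideanLin (jacobiMatrix k a b) x) ⟨m, by omega⟩ =
            ∑ l, jacobiMatrix k a b ⟨m, by omega⟩ l * x l := rfl
        simp only [e1] at e
        rw [Finset.sum_eq_single j] at e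
        · simp only [jacobiMatrix, Matrix.of_apply, PiLp.smul_apply,
            ih ⟨m, by omega⟩ le_rfl, smul_zero] at e
          rw [if_neg (by omega), if_pos (by omega)] at e
          exact (mul_eq_zero.1 e).resolve_left (hb m (by omega))
        · intro l _ hl
          rcases Nat.lt_or_ge m l with hlm | hlm
          · have : (l : ℕ) ≠ j := fun h => hl (Fin.ext h)
            simp only [jacobiMatrix, Matrix.of_apply]
            rw [if_neg (by omega), if_neg (by omega), if_neg (by omega), zero_mul]
          · rw [ih l hlm, mul_zero]
        · simp
      · exact ih j hjm
  ext j
  exact key j j le_rfl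

theorem isSymmetric_jacobiMatrix (k : ℕ) (a b : ℕ → ℝ) :
    (Matrix.toEuclideanLin (jacobiMatrix k a b)).IsSymmetric :=
  Matrix.isSymmetric_toEuclideanLin_iff.mpr (jacobiMatrix_isHermitian k a b)

theorem ritzValue_eq_eigenvalues (k : ℕ) (a b : ℕ → ℝ) (i : Fin k) :
    ritzValue k a b i =
      (isSymmetric_jacobiMatrix k a b).eigenvalues finrank_euclideanSpace_fin i := by
  have gen : ∀ (m : ℕ) (h : m = k) (hn : Module.finrank ℝ (EuclideanSpace ℝ (Fin k)) = m),
      (isSymmetric_jacobiMatrix k a b).eigenvalues hn (Fin.cast h.symm i) =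
        (isSymmetric_jacobiMatrix k a b).eigenvalues finrank_euclideanSpace_fin i := by
    intro m h hn
    subst h
    rfl
  exact gen _ (Fintype.card_fin k) _

theorem ritzValue_injective {k : ℕ} {a b : ℕ → ℝ} (hb : ∀ j, j + 1 < k → b j ≠ 0) :
    Function.Injective (ritzValue k a b) := by
  intro i j hij
  by_contra hne
  have hk : 0 < k := i.pos
  set hT := isSymmetric_jacobiMatrix k a b with hTdef
  set e := hT.eigenvectorBasis finrank_euclideanSpace_fin with he
  rw [ritzValue_eq_eigenvalues, ritzValue_eq_eigenvalues] at hij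
  set r := hT.eigenvalues finrank_euclideanSpace_fin j with hr
  have ei : Matrix.toEuclideanLin (jacobiMatrix k a b) (e i) = r • e i := by
    rw [he, hT.apply_eigenvectorBasis, hij]; rfl
  have ej : Matrix.toEuclideanLin (jacobiMatrix k a b) (e j) = r • e j := by
    rw [he, hT.apply_eigenvectorBasis]; rfl
  have hy : (e j) ⟨0, hk⟩ • e i - (e i) ⟨0, hk⟩ • e j = 0 := by
    refine eq_zero_of_jacobiMatrix_eigenvector (a := a) (b := b) (r := r) hb ?_ ?_
    · rw [map_sub, map_smul, map_smul, ei, ej, smul_sub, smul_comm r, smul_comm r]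
    · intro l hl
      have : l = ⟨0, hk⟩ := Fin.ext hl
      subst this
      simp [mul_comm]
  have hz : (e i) ⟨0, hk⟩ = 0 := by
    have h1 := congrArg (fun z => inner ℝ (e j) z) hy
    simp only [inner_sub_right, inner_smul_right, inner_zero_right] at h1
    rw [e.inner_eq_zero (Ne.symm hne), real_inner_self_eq_norm_sq, e.norm_eq_one] at h1
    simpa using h1
  have : e i = 0 := eq_zero_of_jacobiMatrix_eigenvector (a := a) (b := b) (r := r) hb ei
    fun l hl => by
      have : l = ⟨0, hk⟩ := Fin.ext hl
      subst this
      exact hz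
  have h1 := e.norm_eq_one i
  rw [this, norm_zero] at h1
  exact zero_ne_one h1

theorem sin_lineAngle {k : ℕ} (x y : EuclideanSpace ℝ (Fin k)) :
    Real.sin (lineAngle x y) = Real.sin (InnerProductGeometry.angle x y) := by
  rw [lineAngle]
  rcases min_choice (InnerProductGeometry.angle x y)
    (Real.pi - InnerProductGeometry.angle x y) with h | h <;> rw [h]
  exact Real.sin_pi_sub _

/-- Stability of eigenvectors of Jacobi matrices under perturbation of the entries. -/
theorem mul_sin_lineAngle_le {k : ℕ} {a b a' b' : ℕ → ℝ} {s t : ℝ} (hs : 0 ≤ s) (ht : 0 ≤ t)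
    (ha : ∀ j < k, |a j - a' j| ≤ s) (hb : ∀ j, j + 1 < k → |b j - b' j| ≤ t) {i : Fin k}
    {ε : ℝ} (hε : 0 < ε) (hgap : ∀ j, j ≠ i → ε ≤ |ritzValue k a b i - ritzValue k a b j|)
    {w v : EuclideanSpace ℝ (Fin k)} (hw : IsRitzEigenvector k a' b' i w)
    (hv : IsRitzEigenvector k a b i v) :
    ε * Real.sin (lineAngle w v) ≤ 2 * (s + t + t) := by
  have hE : ((jacobiMatrix k a b) - jacobiMatrix k a' b').IsHermitian :=
    (jacobiMatrix_isHermitian k a b).sub (jacobiMatrix_isHermitian k a' b')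
  rw [sin_lineAngle]
  refine LinearMap.IsSymmetric.mul_sin_angle_le (isSymmetric_jacobiMatrix k a' b')
    (isSymmetric_jacobiMatrix k a b) finrank_euclideanSpace_fin (fun x => ?_) i hε ?_
    hw.2 hv.2 ?_ ?_
  · have := norm_toEuclideanLin_le hE (by positivity) (sum_abs_jacobiMatrix_sub_le ht ha hb) x
    rwa [map_sub, LinearMap.sub_apply] at this
  · intro j hj
    rw [← ritzValue_eq_eigenvalues, ← ritzValue_eq_eigenvalues]
    exact hgap j hj
  · rw [← ritzValue_eq_eigenvalues]
    exact hw.apply_eq_smul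
  · rw [← ritzValue_eq_eigenvalues]
    exact hv.apply_eq_smul

end Lanczos

/-! ### The three-term recurrence of the Lanczos vectors -/

namespace Lanczos

variable {𝕜 : Type*} [RCLike 𝕜] {n : ℕ}

local notation "Eu" => EuclideanSpace 𝕜 (Fin n)

/-- The operator `x ↦ A x` on `𝕜ⁿ`. -/
abbrev op (A : Matrix (Fin n) (Fin n) 𝕜) : Eu →L[𝕜] Eu :=
  Matrix.toEuclideanCLM (n := Fin n) (𝕜 := 𝕜) A

theorem inner_op_left {A : Matrix (Fin n) (Fin n) 𝕜} (hA : A.IsHermitian) (x y : Eu) :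
    inner 𝕜 (op A x) y = inner 𝕜 x (op A y) :=
  Matrix.isSymmetric_toEuclideanLin_iff.mpr hA x y

theorem specNorm_nonneg (A : Matrix (Fin n) (Fin n) 𝕜) : 0 ≤ specNorm A := norm_nonneg _

theorem norm_op_le (A : Matrix (Fin n) (Fin n) 𝕜) (x : Eu) : ‖op A x‖ ≤ specNorm A * ‖x‖ :=
  (op A).le_opNorm x

/-- The Jacobi coefficient `α_j` for an arbitrary starting vector. -/
def alpha (A : Matrix (Fin n) (Fin n) 𝕜) (u : Eu) (j : ℕ) : ℝ :=
  RCLike.re (inner 𝕜 (op A (lanczosVec A u j)) (lanczosVec A u j))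

/-- The Jacobi coefficient `β_j` for an arbitrary starting vector. -/
def beta (A : Matrix (Fin n) (Fin n) 𝕜) (u : Eu) (j : ℕ) : ℝ :=
  ‖residual A (krylov A u j) (lanczosVec A u j)‖

/-- The span of the first `j` Lanczos vectors, so that `krylov A u j = krylovLT A u (j + 1)`. -/
def krylovLT (A : Matrix (Fin n) (Fin n) 𝕜) (u : Eu) (j : ℕ) : Submodule 𝕜 Eu :=
  Submodule.span 𝕜 (Set.range fun i : Fin j => lanczosVec A u i)

/-- The product `β_0 ⋯ β_{j-1}`, the norm of the monic orthogonal polynomial of degree `j`. -/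
def betaProd (A : Matrix (Fin n) (Fin n) 𝕜) (u : Eu) (j : ℕ) : ℝ :=
  ∏ i ∈ Finset.range j, beta A u i

/-- The last term `β_{j-1} v_{j-1}` of the three-term recurrence. It is `0` for `j = 0`. -/
def prevTerm (A : Matrix (Fin n) (Fin n) 𝕜) (u : Eu) : ℕ → Eu
  | 0 => 0
  | j + 1 => ((beta A u j : ℝ) : 𝕜) • lanczosVec A u j

variable {A : Matrix (Fin n) (Fin n) 𝕜} {u : EuclideanSpace 𝕜 (Fin n)}

theorem beta_nonneg (j : ℕ) : 0 ≤ beta A u j := norm_nonneg _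

theorem betaProd_nonneg (j : ℕ) : 0 ≤ betaProd A u j :=
  Finset.prod_nonneg fun i _ => beta_nonneg i

theorem betaProd_zero : betaProd A u 0 = 1 := by simp [betaProd]

theorem betaProd_succ (j : ℕ) : betaProd A u (j + 1) = betaProd A u j * beta A u j := by
  simp [betaProd, Finset.prod_range_succ]

theorem lanczosVec_zero : lanczosVec A u 0 = u := by rw [lanczosVec]

theorem lanczosVec_succ (j : ℕ) : lanczosVec A u (j + 1) =
    (((beta A u j)⁻¹ : ℝ) : 𝕜) • residual A (krylov A u j) (lanczosVec A u j) := by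
  rw [lanczosVec]
  rfl

theorem beta_smul_lanczosVec_succ (j : ℕ) :
    ((beta A u j : ℝ) : 𝕜) • lanczosVec A u (j + 1) =
      residual A (krylov A u j) (lanczosVec A u j) := by
  rw [lanczosVec_succ, smul_smul]
  by_cases h : beta A u j = 0
  · have h2 : residual A (krylov A u j) (lanczosVec A u j) = 0 := norm_eq_zero.1 h
    rw [h2, smul_zero]
  · rw [← RCLike.ofReal_mul, mul_inv_cancel₀ h]
    simp

theorem lanczosVec_mem_krylovLT {i j : ℕ} (h : i < j) : lanczosVec A u i ∈ krylovLT A u j :=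
  Submodule.subset_span ⟨⟨i, h⟩, rfl⟩

theorem krylovLT_mono {i j : ℕ} (h : i ≤ j) : krylovLT A u i ≤ krylovLT A u j := by
  refine Submodule.span_le.2 ?_
  rintro _ ⟨l, rfl⟩
  exact lanczosVec_mem_krylovLT (l.2.trans_le h)

theorem residual_mem_orthogonal (W : Submodule 𝕜 Eu) (v : Eu) : residual A W v ∈ Wᗮ :=
  Submodule.starProjection_apply_mem _ _

theorem op_sub_residual_mem (W : Submodule 𝕜 Eu) (v : Eu) : op A v - residual A W v ∈ W := by
  rw [residual, Submodule.starProjection_orthogonal_val]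
  rw [sub_sub_cancel]
  exact Submodule.starProjection_apply_mem _ _

theorem norm_residual_le (W : Submodule 𝕜 Eu) (v : Eu) : ‖residual A W v‖ ≤ ‖op A v‖ :=
  Submodule.norm_starProjection_apply_le _ _

theorem lanczosVec_mem_orthogonal (j : ℕ) : lanczosVec A u j ∈ (krylovLT A u j)ᗮ := by
  cases j with
  | zero =>
    have : krylovLT A u 0 = ⊥ := by simp [krylovLT]
    rw [this]
    simp
  | succ j =>
    rw [lanczosVec_succ]
    exact Submodule.smul_mem _ _ (residual_mem_orthogonal _ _)

theorem inner_eq_zero_of_mem_krylovLT {j : ℕ} {x : Eu} (hx : x ∈ krylovLT A u j) :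
    inner 𝕜 x (lanczosVec A u j) = 0 :=
  Submodule.inner_right_of_mem_orthogonal hx (lanczosVec_mem_orthogonal j)

theorem inner_lanczosVec_of_lt {i j : ℕ} (h : i < j) :
    inner 𝕜 (lanczosVec A u i) (lanczosVec A u j) = 0 :=
  inner_eq_zero_of_mem_krylovLT (lanczosVec_mem_krylovLT h)

theorem norm_lanczosVec_succ {j : ℕ} (h : beta A u j ≠ 0) : ‖lanczosVec A u (j + 1)‖ = 1 := by
  rw [lanczosVec_succ, norm_smul, RCLike.norm_ofReal, abs_of_nonneg (inv_nonneg.2 (beta_nonneg j))]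
  exact inv_mul_cancel₀ h

theorem lanczosVec_succ_eq_zero {j : ℕ} (h : beta A u j = 0) : lanczosVec A u (j + 1) = 0 := by
  rw [lanczosVec_succ, h]
  simp

theorem lanczosVec_eq_zero_or (hu : ‖u‖ = 1) (j : ℕ) :
    lanczosVec A u j = 0 ∨ ‖lanczosVec A u j‖ = 1 := by
  cases j with
  | zero => exact Or.inr (by rw [lanczosVec_zero, hu])
  | succ j =>
    by_cases h : beta A u j = 0
    · exact Or.inl (lanczosVec_succ_eq_zero h)
    · exact Or.inr (norm_lanczosVec_succ h)

theorem norm_lanczosVec_le_one (hu : ‖u‖ = 1) (j : ℕ) : ‖lanczosVec A u j‖ ≤ 1 := by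
  rcases lanczosVec_eq_zero_or (A := A) hu j with h | h
  · rw [h, norm_zero]; exact zero_le_one
  · exact h.le

theorem beta_eq_zero_of_lanczosVec_eq_zero {j : ℕ} (h : lanczosVec A u j = 0) :
    beta A u j = 0 := by
  rw [beta, h, residual]
  simp

theorem beta_le (hu : ‖u‖ = 1) (j : ℕ) : beta A u j ≤ specNorm A := by
  refine (norm_residual_le _ _).trans ((norm_op_le A _).trans ?_)
  exact mul_le_of_le_one_right (specNorm_nonneg A) (norm_lanczosVec_le_one hu j)

theorem abs_alpha_le (hu : ‖u‖ = 1) (j : ℕ) : |alpha A u j| ≤ specNorm A := by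
  have h1 := norm_lanczosVec_le_one (A := A) hu j
  calc |alpha A u j| ≤ ‖inner 𝕜 (op A (lanczosVec A u j)) (lanczosVec A u j)‖ :=
        RCLike.abs_re_le_norm _
    _ ≤ ‖op A (lanczosVec A u j)‖ * ‖lanczosVec A u j‖ := norm_inner_le_norm _ _
    _ ≤ (specNorm A * 1) * 1 := by
        gcongr
        · simpa using specNorm_nonneg A
        · exact (norm_op_le A _).trans (mul_le_mul_of_nonneg_left h1 (specNorm_nonneg A))
    _ = specNorm A := by ring

theorem betaProd_mul_norm (hu : ‖u‖ = 1) (j : ℕ) :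
    betaProd A u j * ‖lanczosVec A u j‖ = betaProd A u j := by
  cases j with
  | zero => rw [lanczosVec_zero, hu, mul_one]
  | succ j =>
    by_cases h : beta A u j = 0
    · rw [betaProd_succ, h]; simp
    · rw [norm_lanczosVec_succ h, mul_one]

theorem op_mem_krylovLT {j : ℕ} {x : Eu} (hx : x ∈ krylovLT A u j) :
    op A x ∈ krylovLT A u (j + 1) := by
  have : krylovLT A u j ≤ (krylovLT A u (j + 1)).comap (op A : Eu →ₗ[𝕜] Eu) := by
    refine Submodule.span_le.2 ?_
    rintro _ ⟨i, rfl⟩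
    have h1 : op A (lanczosVec A u i) - residual A (krylov A u i) (lanczosVec A u i) ∈
      krylovLT A u (j + 1) :=
      krylovLT_mono (i := i + 1) (by omega) (op_sub_residual_mem _ _)
    have h2 : residual A (krylov A u i) (lanczosVec A u i) ∈ krylovLT A u (j + 1) := by
      rw [← beta_smul_lanczosVec_succ]
      exact Submodule.smul_mem _ _ (lanczosVec_mem_krylovLT (by omega))
    have := Submodule.add_mem _ h1 h2
    rwa [sub_add_cancel] at this
  exact this hx

theorem inner_op_lanczosVec_self (hA : A.IsHermitian) (j : ℕ) :
    inner 𝕜 (lanczosVec A u j) (op A (lanczosVec A u j)) = ((alpha A u j : ℝ) : 𝕜) := by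
  have h1 := inner_op_left hA (lanczosVec A u j) (lanczosVec A u j)
  have h2 : (starRingEnd 𝕜) (inner 𝕜 (op A (lanczosVec A u j)) (lanczosVec A u j)) =
      inner 𝕜 (op A (lanczosVec A u j)) (lanczosVec A u j) := by
    rw [inner_conj_symm, h1]
  rw [← h1, alpha]
  exact (RCLike.conj_eq_iff_re.1 h2).symm

theorem inner_op_lanczosVec_of_lt (hA : A.IsHermitian) {i j : ℕ} (h : i < j) :
    inner 𝕜 (lanczosVec A u i) (op A (lanczosVec A u j)) =
      ((beta A u i : ℝ) : 𝕜) * inner 𝕜 (lanczosVec A u (i + 1)) (lanczosVec A u j) := by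
  rw [← inner_op_left hA]
  have h1 := op_sub_residual_mem (A := A) (krylov A u i) (lanczosVec A u i)
  have h2 : inner 𝕜 (op A (lanczosVec A u i) - residual A (krylov A u i) (lanczosVec A u i))
      (lanczosVec A u j) = 0 :=
    inner_eq_zero_of_mem_krylovLT (krylovLT_mono (i := i + 1) h h1)
  rw [inner_sub_left, sub_eq_zero] at h2
  rw [h2, ← beta_smul_lanczosVec_succ, inner_smul_left, RCLike.conj_ofReal]

theorem prevTerm_mem (j : ℕ) : prevTerm A u j ∈ krylovLT A u j := by
  cases j with
  | zero => exact Submodule.zero_mem _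
  | succ j => exact Submodule.smul_mem _ _ (lanczosVec_mem_krylovLT (Nat.lt_succ_self j))

/-- The three-term recurrence. -/
theorem op_lanczosVec (hA : A.IsHermitian) (hu : ‖u‖ = 1) (j : ℕ) :
    op A (lanczosVec A u j) = ((beta A u j : ℝ) : 𝕜) • lanczosVec A u (j + 1) +
      ((alpha A u j : ℝ) : 𝕜) • lanczosVec A u j + prevTerm A u j := by
  set y := op A (lanczosVec A u j) - ((beta A u j : ℝ) : 𝕜) • lanczosVec A u (j + 1) -
    ((alpha A u j : ℝ) : 𝕜) • lanczosVec A u j - prevTerm A u j with hy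
  have hmem : y ∈ krylovLT A u (j + 1) := by
    refine Submodule.sub_mem _ (Submodule.sub_mem _ ?_ ?_) ?_
    · rw [beta_smul_lanczosVec_succ]
      exact op_sub_residual_mem (krylov A u j) _
    · exact Submodule.smul_mem _ _ (lanczosVec_mem_krylovLT (Nat.lt_succ_self j))
    · exact krylovLT_mono (Nat.le_succ j) (prevTerm_mem j)
  have horth : ∀ i, i < j + 1 → inner 𝕜 (lanczosVec A u i) y = 0 := by
    intro i hi
    rw [hy, inner_sub_right, inner_sub_right, inner_sub_right, inner_smul_right, inner_smul_right,
      inner_lanczosVec_of_lt hi, mul_zero, sub_zero]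
    rcases Nat.lt_succ_iff_lt_or_eq.1 hi with h | h
    · rw [inner_op_lanczosVec_of_lt hA h, inner_lanczosVec_of_lt h, mul_zero, sub_zero]
      cases j with
      | zero => omega
      | succ j =>
        rw [prevTerm, inner_smul_right]
        rcases Nat.lt_succ_iff_lt_or_eq.1 h with h' | h'
        · rw [inner_lanczosVec_of_lt h', inner_lanczosVec_of_lt (Nat.succ_lt_succ h')]
          simp
        · subst h'
          by_cases hb : beta A u i = 0
          · rw [hb]; simp
          · have h1 : ‖lanczosVec A u i‖ = 1 :=
              (lanczosVec_eq_zero_or hu i).resolve_left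
                fun h0 => hb (beta_eq_zero_of_lanczosVec_eq_zero h0)
            rw [inner_self_eq_norm_sq_to_K, inner_self_eq_norm_sq_to_K, h1,
              norm_lanczosVec_succ hb, sub_self]
    · subst h
      have h0 : inner 𝕜 (lanczosVec A u i) (prevTerm A u i) = 0 := by
        rw [← inner_conj_symm, inner_eq_zero_of_mem_krylovLT (prevTerm_mem i), map_zero]
      rw [h0, inner_op_lanczosVec_self hA, sub_zero]
      rcases lanczosVec_eq_zero_or (A := A) hu i with h1 | h1
      · simp [alpha, h1]
      · rw [inner_self_eq_norm_sq_to_K, h1]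
        simp
  have hzero : inner 𝕜 y y = 0 := by
    have hle : krylovLT A u (j + 1) ≤ (𝕜 ∙ y)ᗮ := by
      refine Submodule.span_le.2 ?_
      rintro _ ⟨i, rfl⟩
      rw [SetLike.mem_coe, Submodule.mem_orthogonal_singleton_iff_inner_left]
      exact horth i i.2
    exact Submodule.mem_orthogonal_singleton_iff_inner_right.1 (hle hmem)
  have hy0 := inner_self_eq_zero.1 hzero
  rw [hy, sub_sub, sub_sub, sub_eq_zero] at hy0
  rw [hy0]
  abel

theorem norm_op_sub_alpha_smul_le (hA : A.IsHermitian) (hu : ‖u‖ = 1) (j : ℕ) :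
    ‖op A (lanczosVec A u j) - ((alpha A u j : ℝ) : 𝕜) • lanczosVec A u j‖ ≤ specNorm A := by
  have h1 : inner 𝕜 (((alpha A u j : ℝ) : 𝕜) • lanczosVec A u j)
      (op A (lanczosVec A u j) - ((alpha A u j : ℝ) : 𝕜) • lanczosVec A u j) = 0 := by
    rw [inner_smul_left, inner_sub_right, inner_smul_right, inner_op_lanczosVec_self hA]
    rcases lanczosVec_eq_zero_or (A := A) hu j with h1 | h1
    · simp [alpha, h1]
    · rw [inner_self_eq_norm_sq_to_K, h1]
      simp
  have h2 := norm_add_sq_eq_norm_sq_add_norm_sq_of_inner_eq_zero _ _ h1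
  rw [add_sub_cancel] at h2
  have h3 : ‖op A (lanczosVec A u j)‖ ≤ specNorm A :=
    (norm_op_le A _).trans
      (mul_le_of_le_one_right (specNorm_nonneg A) (norm_lanczosVec_le_one hu j))
  nlinarith [norm_nonneg (((alpha A u j : ℝ) : 𝕜) • lanczosVec A u j),
    norm_nonneg (op A (lanczosVec A u j)),
    norm_nonneg (op A (lanczosVec A u j) - ((alpha A u j : ℝ) : 𝕜) • lanczosVec A u j)]

end Lanczos

/-! ### Polynomials in the matrix -/

namespace Lanczos

open Polynomial

variable {𝕜 : Type*} [RCLike 𝕜] {n : ℕ}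

local notation "Eu" => EuclideanSpace 𝕜 (Fin n)

/-- The operator `p(A)` on `𝕜ⁿ`, for a real polynomial `p`. -/
def polyOp (A : Matrix (Fin n) (Fin n) 𝕜) (p : ℝ[X]) : Eu →ₗ[𝕜] Eu :=
  aeval ((op A : Eu →L[𝕜] Eu) : Module.End 𝕜 Eu) (p.map (algebraMap ℝ 𝕜))

variable {A : Matrix (Fin n) (Fin n) 𝕜} {u : EuclideanSpace 𝕜 (Fin n)}

theorem polyOp_one : polyOp A 1 = LinearMap.id := by
  simp [polyOp]
  rfl

theorem polyOp_sub (p q : ℝ[X]) : polyOp A (p - q) = polyOp A p - polyOp A q := by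
  simp [polyOp]

theorem polyOp_X_mul (p : ℝ[X]) (x : Eu) : polyOp A (X * p) x = op A (polyOp A p x) := by
  simp [polyOp]

theorem polyOp_C_mul (c : ℝ) (p : ℝ[X]) (x : Eu) :
    polyOp A (C c * p) x = ((c : ℝ) : 𝕜) • polyOp A p x := by
  simp [polyOp, Algebra.algebraMap_eq_smul_one]

theorem op_eigenvectorBasis (hA : A.IsHermitian) (i : Fin n) :
    op A (hA.eigenvectorBasis i) = ((hA.eigenvalues i : ℝ) : 𝕜) • hA.eigenvectorBasis i := by
  have h := hA.mulVec_eigenvectorBasis i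
  apply (WithLp.equiv 2 (Fin n → 𝕜)).injective
  rw [← RCLike.real_smul_eq_coe_smul (K := 𝕜)]
  exact h

theorem abs_eigenvalues_le (hA : A.IsHermitian) (i : Fin n) :
    |hA.eigenvalues i| ≤ specNorm A := by
  have h := norm_op_le A (hA.eigenvectorBasis i)
  rw [op_eigenvectorBasis, norm_smul, RCLike.norm_ofReal,
    hA.eigenvectorBasis.norm_eq_one, mul_one, mul_one] at h
  exact h

theorem polyOp_eigenvectorBasis (hA : A.IsHermitian) (p : ℝ[X]) (i : Fin n) :
    polyOp A p (hA.eigenvectorBasis i) =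
      ((p.eval (hA.eigenvalues i) : ℝ) : 𝕜) • hA.eigenvectorBasis i := by
  have hev : Module.End.HasEigenvector ((op A : Eu →L[𝕜] Eu) : Module.End 𝕜 Eu)
      ((hA.eigenvalues i : ℝ) : 𝕜) (hA.eigenvectorBasis i) := by
    refine ⟨Module.End.mem_eigenspace_iff.2 (op_eigenvectorBasis hA i), ?_⟩
    intro h0
    have := hA.eigenvectorBasis.norm_eq_one i
    rw [h0, norm_zero] at this
    exact zero_ne_one this
  rw [polyOp, Module.End.aeval_apply_of_hasEigenvector hev]
  congr 1
  rw [← RCLike.algebraMap_eq_ofReal, eval_map_algebraMap, aeval_algebraMap_apply]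
  simp

theorem inner_eigenvectorBasis_polyOp (hA : A.IsHermitian) (p : ℝ[X]) (i : Fin n) (x : Eu) :
    inner 𝕜 (hA.eigenvectorBasis i) (polyOp A p x) =
      ((p.eval (hA.eigenvalues i) : ℝ) : 𝕜) * inner 𝕜 (hA.eigenvectorBasis i) x := by
  conv_lhs => rw [← hA.eigenvectorBasis.sum_repr' x]
  rw [map_sum, inner_sum, Finset.sum_eq_single i]
  · rw [map_smul, polyOp_eigenvectorBasis, inner_smul_right, inner_smul_right,
      inner_self_eq_norm_sq_to_K, hA.eigenvectorBasis.norm_eq_one]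
    simp [mul_comm]
  · intro j _ hj
    rw [map_smul, polyOp_eigenvectorBasis, inner_smul_right, inner_smul_right,
      hA.eigenvectorBasis.inner_eq_zero (Ne.symm hj)]
    simp
  · simp

theorem norm_polyOp_sq (hA : A.IsHermitian) (p : ℝ[X]) (x : Eu) :
    ‖polyOp A p x‖ ^ 2 = ∑ i, p.eval (hA.eigenvalues i) ^ 2 *
      ‖inner 𝕜 (hA.eigenvectorBasis i) x‖ ^ 2 := by
  rw [← hA.eigenvectorBasis.sum_sq_norm_inner_right]
  refine Finset.sum_congr rfl fun i _ => ?_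
  rw [inner_eigenvectorBasis_polyOp, norm_mul, mul_pow, RCLike.norm_ofReal, sq_abs]

theorem norm_polyOp_le_of_abs_eval_le (hA : A.IsHermitian) {p q : ℝ[X]}
    (h : ∀ i, |p.eval (hA.eigenvalues i)| ≤ |q.eval (hA.eigenvalues i)|) (x : Eu) :
    ‖polyOp A p x‖ ≤ ‖polyOp A q x‖ := by
  refine (sq_le_sq₀ (norm_nonneg _) (norm_nonneg _)).1 ?_
  rw [norm_polyOp_sq hA, norm_polyOp_sq hA]
  refine Finset.sum_le_sum fun i _ => mul_le_mul_of_nonneg_right ?_ (sq_nonneg _)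
  exact sq_le_sq.2 (h i)

theorem norm_polyOp_le (hA : A.IsHermitian) {p : ℝ[X]} {c : ℝ} (hc : 0 ≤ c)
    (h : ∀ i, |p.eval (hA.eigenvalues i)| ≤ c) (x : Eu) : ‖polyOp A p x‖ ≤ c * ‖x‖ := by
  have h1 := norm_polyOp_le_of_abs_eval_le hA (p := p) (q := C c * 1)
    (fun i => by simpa [abs_of_nonneg hc] using h i) x
  rwa [polyOp_C_mul, polyOp_one, norm_smul, RCLike.norm_ofReal, abs_of_nonneg hc] at h1

theorem polyOp_X_pow_mem (i : ℕ) : polyOp A (X ^ i) u ∈ krylovLT A u (i + 1) := by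
  induction i with
  | zero =>
    rw [pow_zero, polyOp_one]
    have := lanczosVec_mem_krylovLT (A := A) (u := u) (Nat.lt_succ_self 0)
    rwa [lanczosVec_zero] at this
  | succ i ih =>
    rw [pow_succ', polyOp_X_mul]
    exact op_mem_krylovLT ih

theorem polyOp_mem_krylovLT {p : ℝ[X]} {j : ℕ} (hp : p.degree < j) :
    polyOp A p u ∈ krylovLT A u j := by
  have e : polyOp A p u = ∑ i ∈ p.support, ((p.coeff i : ℝ) : 𝕜) • polyOp A (X ^ i) u := by
    conv_lhs => rw [p.as_sum_support_C_mul_X_pow]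
    simp_rw [← polyOp_C_mul]
    simp [polyOp, Polynomial.map_sum, LinearMap.sum_apply]
  rw [e]
  refine Submodule.sum_mem _ fun i hi => Submodule.smul_mem _ _ ?_
  have h1 : i < j := by
    have := (le_degree_of_ne_zero (mem_support_iff.1 hi)).trans_lt hp
    exact_mod_cast this
  exact krylovLT_mono h1 (polyOp_X_pow_mem i)

theorem polyOp_mem_krylovLT_succ {p : ℝ[X]} (hp : p.Monic) :
    polyOp A p u ∈ krylovLT A u (p.natDegree + 1) := by
  refine polyOp_mem_krylovLT ?_
  rw [degree_eq_natDegree hp.ne_zero]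
  exact_mod_cast Nat.lt_succ_self _

/-- The vector `β_0 ⋯ β_{j-1} v_j` is the value at the starting vector of a monic polynomial in
`A` of degree `j`. -/
theorem exists_monic_polyOp_eq (hA : A.IsHermitian) (hu : ‖u‖ = 1) (j : ℕ) :
    ∃ q : ℝ[X], q.Monic ∧ q.natDegree = j ∧
      polyOp A q u = ((betaProd A u j : ℝ) : 𝕜) • lanczosVec A u j := by
  have step : ∀ j, ((betaProd A u (j + 1) : ℝ) : 𝕜) • lanczosVec A u (j + 1) =
      op A (((betaProd A u j : ℝ) : 𝕜) • lanczosVec A u j) -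
        ((alpha A u j : ℝ) : 𝕜) • (((betaProd A u j : ℝ) : 𝕜) • lanczosVec A u j) -
        ((betaProd A u j : ℝ) : 𝕜) • prevTerm A u j := by
    intro j
    rw [map_smul, op_lanczosVec hA hu j, betaProd_succ, RCLike.ofReal_mul]
    module
  have hmonic : ∀ (q : ℝ[X]) (c : ℝ), q.Monic →
      ((X - C c) * q).Monic ∧ ((X - C c) * q).natDegree = q.natDegree + 1 := by
    intro q c hq
    refine ⟨(monic_X_sub_C c).mul hq, ?_⟩
    rw [(monic_X_sub_C c).natDegree_mul hq, natDegree_X_sub_C, add_comm]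
  have happly : ∀ (q : ℝ[X]) (c : ℝ), polyOp A ((X - C c) * q) u =
      op A (polyOp A q u) - ((c : ℝ) : 𝕜) • polyOp A q u := by
    intro q c
    rw [sub_mul, polyOp_sub, LinearMap.sub_apply, polyOp_X_mul, polyOp_C_mul]
  induction j using Nat.strong_induction_on with
  | _ j ih =>
    match j with
    | 0 => exact ⟨1, monic_one, natDegree_one, by
        rw [polyOp_one, betaProd_zero, lanczosVec_zero]; simp⟩
    | 1 =>
      obtain ⟨q, hq, hqd, hqu⟩ := ih 0 (by omega)
      refine ⟨(X - C (alpha A u 0)) * q, (hmonic q _ hq).1, by rw [(hmonic q _ hq).2, hqd], ?_⟩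
      rw [happly, hqu, step 0, prevTerm, smul_zero, sub_zero]
    | j + 2 =>
      obtain ⟨q, hq, hqd, hqu⟩ := ih (j + 1) (by omega)
      obtain ⟨q', hq', hqd', hqu'⟩ := ih j (by omega)
      have h1 := hmonic q (alpha A u (j + 1)) hq
      have hlt : (C (beta A u j ^ 2) * q').degree <
          ((X - C (alpha A u (j + 1))) * q).degree := by
        refine lt_of_le_of_lt ((degree_mul_le _ _).trans (add_le_add degree_C_le le_rfl)) ?_
        rw [zero_add, degree_eq_natDegree hq'.ne_zero, degree_eq_natDegree h1.1.ne_zero, h1.2, hqd, hqd']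
        exact_mod_cast (by omega : j < j + 1 + 1)
      refine ⟨(X - C (alpha A u (j + 1))) * q - C (beta A u j ^ 2) * q',
        h1.1.sub_of_left hlt, ?_, ?_⟩
      · rw [natDegree_sub_eq_left_of_natDegree_lt, h1.2, hqd]
        refine (natDegree_C_mul_le _ _).trans_lt ?_
        omega
      · rw [polyOp_sub, LinearMap.sub_apply, happly, polyOp_C_mul, hqu, hqu', step (j + 1),
          prevTerm, betaProd_succ, RCLike.ofReal_mul, RCLike.ofReal_pow]
        module

theorem polyOp_sub_mem (hA : A.IsHermitian) (hu : ‖u‖ = 1) {p : ℝ[X]} (hp : p.Monic) {j : ℕ}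
    (hj : p.natDegree = j) :
    polyOp A p u - ((betaProd A u j : ℝ) : 𝕜) • lanczosVec A u j ∈ krylovLT A u j := by
  obtain ⟨q, hq, hqd, hqu⟩ := exists_monic_polyOp_eq hA hu j
  rw [← hqu, ← LinearMap.sub_apply, ← polyOp_sub]
  refine polyOp_mem_krylovLT ?_
  rw [← hj, ← degree_eq_natDegree hp.ne_zero]
  refine degree_sub_lt_left ?_ hp.ne_zero (by rw [hp.leadingCoeff, hq.leadingCoeff])
  rw [degree_eq_natDegree hp.ne_zero, degree_eq_natDegree hq.ne_zero, hj, hqd]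

theorem norm_betaProd_smul (hu : ‖u‖ = 1) (j : ℕ) :
    ‖((betaProd A u j : ℝ) : 𝕜) • lanczosVec A u j‖ = betaProd A u j := by
  rw [norm_smul, RCLike.norm_ofReal, abs_of_nonneg (betaProd_nonneg j), betaProd_mul_norm hu]

theorem norm_polyOp_sq_eq_add (hA : A.IsHermitian) (hu : ‖u‖ = 1) {p : ℝ[X]} (hp : p.Monic)
    {j : ℕ} (hj : p.natDegree = j) :
    ‖polyOp A p u‖ ^ 2 = betaProd A u j ^ 2 +
      ‖polyOp A p u - ((betaProd A u j : ℝ) : 𝕜) • lanczosVec A u j‖ ^ 2 := by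
  have h1 : inner 𝕜 (polyOp A p u - ((betaProd A u j : ℝ) : 𝕜) • lanczosVec A u j)
      (((betaProd A u j : ℝ) : 𝕜) • lanczosVec A u j) = 0 := by
    rw [inner_smul_right, inner_eq_zero_of_mem_krylovLT (polyOp_sub_mem hA hu hp hj), mul_zero]
  have h2 := norm_add_sq_eq_norm_sq_add_norm_sq_of_inner_eq_zero _ _ h1
  rw [sub_add_cancel, norm_betaProd_smul hu] at h2
  nlinarith

/-- Monic orthogonal polynomials have the least `L²` norm among monic polynomials. -/
theorem betaProd_le_norm_polyOp (hA : A.IsHermitian) (hu : ‖u‖ = 1) {p : ℝ[X]} (hp : p.Monic)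
    {j : ℕ} (hj : p.natDegree = j) : betaProd A u j ≤ ‖polyOp A p u‖ := by
  refine (sq_le_sq₀ (betaProd_nonneg j) (norm_nonneg _)).1 ?_
  rw [norm_polyOp_sq_eq_add hA hu hp hj]
  nlinarith [sq_nonneg ‖polyOp A p u - ((betaProd A u j : ℝ) : 𝕜) • lanczosVec A u j‖]

theorem polyOp_eq_of_norm_le (hA : A.IsHermitian) (hu : ‖u‖ = 1) {p : ℝ[X]} (hp : p.Monic)
    {j : ℕ} (hj : p.natDegree = j) (hle : ‖polyOp A p u‖ ≤ betaProd A u j) :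
    polyOp A p u = ((betaProd A u j : ℝ) : 𝕜) • lanczosVec A u j := by
  have h1 := norm_polyOp_sq_eq_add hA hu hp hj
  have h2 : ‖polyOp A p u‖ ^ 2 ≤ betaProd A u j ^ 2 := by gcongr
  have h3 : ‖polyOp A p u - ((betaProd A u j : ℝ) : 𝕜) • lanczosVec A u j‖ ^ 2 = 0 :=
    le_antisymm (by linarith) (sq_nonneg _)
  exact sub_eq_zero.1 (norm_eq_zero.1 (pow_eq_zero_iff two_ne_zero |>.1 h3))

/-- The monic polynomial with the roots `x r`. -/
def rootPoly {j : ℕ} (x : Fin j → ℝ) : ℝ[X] := ∏ r, (X - C (x r))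

theorem monic_rootPoly {j : ℕ} (x : Fin j → ℝ) : (rootPoly x).Monic :=
  monic_prod_of_monic _ _ fun _ _ => monic_X_sub_C _

theorem natDegree_rootPoly {j : ℕ} (x : Fin j → ℝ) : (rootPoly x).natDegree = j := by
  rw [rootPoly, natDegree_prod_of_monic _ _ fun _ _ => monic_X_sub_C _]
  simp

theorem eval_rootPoly {j : ℕ} (x : Fin j → ℝ) (t : ℝ) :
    (rootPoly x).eval t = ∏ r, (t - x r) := by
  simp [rootPoly, eval_prod]

/-- Moving the complex roots of a real monic polynomial to the nearest points of `[-R, R]` makes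
the polynomial smaller on that interval. -/
theorem exists_rootPoly_abs_eval_le {p : ℝ[X]} (hp : p.Monic) {j : ℕ} (hj : p.natDegree = j)
    {R : ℝ} (hR : 0 ≤ R) :
    ∃ x : Fin j → ℝ, (∀ r, |x r| ≤ R) ∧
      ∀ t : ℝ, |t| ≤ R → |(rootPoly x).eval t| ≤ |p.eval t| := by
  set P := p.map (algebraMap ℝ ℂ) with hP
  have hPm : P.Monic := hp.map _
  have hPs : P.Splits := IsAlgClosed.splits P
  have hcard : P.roots.card = j := by
    rw [← hPs.natDegree_eq_card_roots, hP, natDegree_map, hj]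
  set l := P.roots.toList with hl
  have hlen : l.length = j := by rw [hl, Multiset.length_toList, hcard]
  set cl : ℂ → ℝ := fun z => max (-R) (min R z.re) with hcl
  have hcl1 : ∀ z, |cl z| ≤ R := fun z => by
    rw [abs_le]
    exact ⟨le_max_left _ _, max_le (by linarith) (min_le_left _ _)⟩
  have hcl2 : ∀ (z : ℂ) (t : ℝ), |t| ≤ R → |t - cl z| ≤ ‖(t : ℂ) - z‖ := by
    intro z t ht
    have h1 : |t - z.re| ≤ ‖(t : ℂ) - z‖ := by
      have := Complex.abs_re_le_norm ((t : ℂ) - z)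
      simpa using this
    refine le_trans ?_ h1
    obtain ⟨h2, h3⟩ := abs_le.1 ht
    simp only [hcl]
    rcases le_total R z.re with h | h
    · rw [min_eq_left h, max_eq_right (by linarith), abs_of_nonpos (by linarith),
        abs_of_nonpos (by linarith)]
      linarith
    · rw [min_eq_right h]
      rcases le_total z.re (-R) with h' | h'
      · rw [max_eq_left h', abs_of_nonneg (by linarith), abs_of_nonneg (by linarith)]
        linarith
      · rw [max_eq_right h']
  refine ⟨fun r => cl (l.get (Fin.cast hlen.symm r)), fun r => hcl1 _, fun t ht => ?_⟩
  have e1 : ((p.eval t : ℝ) : ℂ) = ∏ r : Fin j, ((t : ℂ) - l.get (Fin.cast hlen.symm r)) := by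
    have h1 : ((p.eval t : ℝ) : ℂ) = P.eval (t : ℂ) := by
      rw [hP, eval_map_algebraMap]
      exact (aeval_algebraMap_apply ℂ t p).symm
    have h2 : P.eval (t : ℂ) = (l.map fun z => (t : ℂ) - z).prod := by
      rw [hPs.eval_eq_prod_roots_of_monic hPm, ← Multiset.coe_toList P.roots, Multiset.map_coe,
        Multiset.prod_coe]
    rw [h1, h2]
    subst hlen
    conv_lhs => rw [← List.ofFn_get l, List.map_ofFn, List.prod_ofFn]
    rfl
  have e2 : |p.eval t| = ∏ r : Fin j, ‖(t : ℂ) - l.get (Fin.cast hlen.symm r)‖ := by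
    rw [← norm_prod, ← e1, Complex.norm_real, Real.norm_eq_abs]
  rw [eval_rootPoly, Finset.abs_prod, e2]
  exact Finset.prod_le_prod (fun r _ => abs_nonneg _) fun r _ => hcl2 _ t ht

/-- The monic orthogonal polynomials may be taken with all roots in `[-‖A‖, ‖A‖]`. -/
theorem exists_rootPoly_polyOp_eq (hA : A.IsHermitian) (hu : ‖u‖ = 1) (j : ℕ) :
    ∃ x : Fin j → ℝ, (∀ r, |x r| ≤ specNorm A) ∧
      polyOp A (rootPoly x) u = ((betaProd A u j : ℝ) : 𝕜) • lanczosVec A u j := by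
  obtain ⟨q, hq, hqd, hqu⟩ := exists_monic_polyOp_eq hA hu j
  obtain ⟨x, hx, hle⟩ := exists_rootPoly_abs_eval_le hq hqd (specNorm_nonneg A)
  refine ⟨x, hx, polyOp_eq_of_norm_le hA hu (monic_rootPoly x) (natDegree_rootPoly x) ?_⟩
  rw [← norm_betaProd_smul (A := A) hu j, ← hqu]
  exact norm_polyOp_le_of_abs_eval_le hA (fun i => hle _ (abs_eigenvalues_le hA i)) u

theorem norm_polyOp_rootPoly_le (hA : A.IsHermitian) {j : ℕ} {x : Fin j → ℝ}
    (hx : ∀ r, |x r| ≤ specNorm A) (y : Eu) :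
    ‖polyOp A (rootPoly x) y‖ ≤ (2 * specNorm A) ^ j * ‖y‖ := by
  have hR := specNorm_nonneg A
  refine norm_polyOp_le hA (by positivity) (fun i => ?_) y
  rw [eval_rootPoly, Finset.abs_prod]
  calc ∏ r, |hA.eigenvalues i - x r| ≤ ∏ _r : Fin j, 2 * specNorm A := by
        refine Finset.prod_le_prod (fun r _ => abs_nonneg _) fun r _ => ?_
        have := abs_sub (hA.eigenvalues i) (x r)
        linarith [abs_eigenvalues_le hA i, hx r]
    _ = _ := by simp

end Lanczos

/-! ### Lipschitz estimates for the Jacobi coefficients -/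

namespace Lanczos

variable {𝕜 : Type*} [RCLike 𝕜] {n : ℕ} {A : Matrix (Fin n) (Fin n) 𝕜}
  {u u' : EuclideanSpace 𝕜 (Fin n)}

theorem betaProd_le_add (hA : A.IsHermitian) (hu : ‖u‖ = 1) (hu' : ‖u'‖ = 1) (j : ℕ) :
    betaProd A u j ≤ betaProd A u' j + (2 * specNorm A) ^ j * ‖u - u'‖ := by
  obtain ⟨x, hx, hxu⟩ := exists_rootPoly_polyOp_eq hA hu' j
  calc betaProd A u j ≤ ‖polyOp A (rootPoly x) u‖ :=
        betaProd_le_norm_polyOp hA hu (monic_rootPoly x) (natDegree_rootPoly x)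
    _ = ‖polyOp A (rootPoly x) u' + polyOp A (rootPoly x) (u - u')‖ := by
        rw [← map_add, add_sub_cancel]
    _ ≤ ‖polyOp A (rootPoly x) u'‖ + ‖polyOp A (rootPoly x) (u - u')‖ := norm_add_le _ _
    _ ≤ _ := by
        rw [hxu, norm_betaProd_smul hu']
        gcongr
        exact norm_polyOp_rootPoly_le hA hx _

theorem abs_betaProd_sub_le (hA : A.IsHermitian) (hu : ‖u‖ = 1) (hu' : ‖u'‖ = 1) (j : ℕ) :
    |betaProd A u j - betaProd A u' j| ≤ (2 * specNorm A) ^ j * ‖u - u'‖ := by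
  rw [abs_sub_le_iff]
  constructor
  · linarith [betaProd_le_add hA hu hu' j]
  · have := betaProd_le_add hA hu' hu j
    rw [norm_sub_rev] at this
    linarith

theorem betaProd_le_mul_pow (hu : ‖u‖ = 1) {j m : ℕ} (hjm : j ≤ m) :
    betaProd A u m ≤ betaProd A u j * specNorm A ^ (m - j) := by
  obtain ⟨d, rfl⟩ := Nat.exists_eq_add_of_le hjm
  rw [Nat.add_sub_cancel_left]
  induction d with
  | zero => simp
  | succ d ih =>
    rw [← add_assoc, betaProd_succ, pow_succ, ← mul_assoc]
    exact mul_le_mul (ih (by omega)) (beta_le hu _) (beta_nonneg _)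
      (mul_nonneg (betaProd_nonneg _) (pow_nonneg (specNorm_nonneg A) _))

/-- The quotient `β_j = betaProd (j + 1) / betaProd j` of two Lipschitz functions is Lipschitz
where the denominator is bounded below. -/
theorem abs_beta_sub_mul_le (hA : A.IsHermitian) (hu : ‖u‖ = 1) (hu' : ‖u'‖ = 1) (j : ℕ) :
    |beta A u j - beta A u' j| * betaProd A u j ≤
      3 * specNorm A * (2 * specNorm A) ^ j * ‖u - u'‖ := by
  have e : (beta A u j - beta A u' j) * betaProd A u j =
      (betaProd A u (j + 1) - betaProd A u' (j + 1)) -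
        beta A u' j * (betaProd A u j - betaProd A u' j) := by
    rw [betaProd_succ, betaProd_succ]; ring
  have h1 := abs_betaProd_sub_le hA hu hu' (j + 1)
  have h2 := abs_betaProd_sub_le hA hu hu' j
  have h3 := beta_le (A := A) hu' j
  have h4 := beta_nonneg (A := A) (u := u') j
  calc |beta A u j - beta A u' j| * betaProd A u j
      = |(beta A u j - beta A u' j) * betaProd A u j| := by
        rw [abs_mul, abs_of_nonneg (betaProd_nonneg j)]
    _ ≤ |betaProd A u (j + 1) - betaProd A u' (j + 1)| +
        |beta A u' j * (betaProd A u j - betaProd A u' j)| := by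
        rw [e]; exact abs_sub _ _
    _ ≤ (2 * specNorm A) ^ (j + 1) * ‖u - u'‖ +
        specNorm A * ((2 * specNorm A) ^ j * ‖u - u'‖) := by
        rw [abs_mul, abs_of_nonneg h4]
        gcongr
        exact specNorm_nonneg A
    _ = _ := by ring

/-- With `w = betaProd j • v_j` for the starting vector `u` and `w'` likewise for `u'`: the vector
`(A - α_j) w` is almost orthogonal to `w'`, because it is a combination of `v_{j+1}` and
`v_{j-1}`. -/
theorem norm_inner_op_sub_le (hA : A.IsHermitian) (hu : ‖u‖ = 1) (hu' : ‖u'‖ = 1) (j : ℕ) :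
    ‖inner 𝕜 (op A (((betaProd A u j : ℝ) : 𝕜) • lanczosVec A u j) -
        ((alpha A u j : ℝ) : 𝕜) • ((betaProd A u j : ℝ) : 𝕜) • lanczosVec A u j)
      (((betaProd A u' j : ℝ) : 𝕜) • lanczosVec A u' j)‖ ≤
      specNorm A * (2 * specNorm A) ^ j * ‖u - u'‖ *
        (2 * betaProd A u j + betaProd A u' j / 2) := by
  have hR := specNorm_nonneg A
  set R := specNorm A with hRdef
  set D := betaProd A u j with hD
  set D' := betaProd A u' j with hD'
  set M := (2 * R) ^ j with hM
  have hM0 : 0 ≤ M := by positivity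
  have hD0 : 0 ≤ D := betaProd_nonneg j
  have hD0' : 0 ≤ D' := betaProd_nonneg j
  obtain ⟨x, hx, hxu⟩ := exists_rootPoly_polyOp_eq hA hu' j
  set w' := ((D' : ℝ) : 𝕜) • lanczosVec A u' j with hw'
  set P := polyOp A (rootPoly x) with hP
  set y := op A (((D : ℝ) : 𝕜) • lanczosVec A u j) -
        ((alpha A u j : ℝ) : 𝕜) • ((D : ℝ) : 𝕜) • lanczosVec A u j with hy
  have hPle : ∀ z, ‖P z‖ ≤ M * ‖z‖ := norm_polyOp_rootPoly_le hA hx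
  have hy1 : y = ((D : ℝ) : 𝕜) • (op A (lanczosVec A u j) -
      ((alpha A u j : ℝ) : 𝕜) • lanczosVec A u j) := by
    rw [hy, map_smul]; module
  have hyn : ‖y‖ ≤ D * R := by
    rw [hy1, norm_smul, RCLike.norm_ofReal, abs_of_nonneg hD0]
    exact mul_le_mul_of_nonneg_left (norm_op_sub_alpha_smul_le hA hu j) hD0
  have hy2 : y = ((D : ℝ) : 𝕜) • ((beta A u j : ℝ) : 𝕜) • lanczosVec A u (j + 1) +
      ((D : ℝ) : 𝕜) • prevTerm A u j := by
    rw [hy1, op_lanczosVec hA hu j]; module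
  have hdist : ‖u' - u‖ = ‖u - u'‖ := norm_sub_rev _ _
  have hPu : P u ∈ krylovLT A u (j + 1) := by
    have := polyOp_mem_krylovLT_succ (A := A) (u := u) (monic_rootPoly x)
    rwa [natDegree_rootPoly] at this
  have hlead : inner 𝕜 (((D : ℝ) : 𝕜) • ((beta A u j : ℝ) : 𝕜) • lanczosVec A u (j + 1)) (P u)
      = 0 := by
    have := inner_eq_zero_of_mem_krylovLT hPu
    rw [smul_smul, inner_smul_left, ← inner_conj_symm, this]
    simp
  have hprev : ‖inner 𝕜 (((D : ℝ) : 𝕜) • prevTerm A u j) (P u)‖ ≤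
      R * M * ‖u - u'‖ * (D + D' / 2) := by
    cases j with
    | zero =>
      rw [prevTerm, smul_zero, inner_zero_left, norm_zero]
      positivity
    | succ i =>
      obtain ⟨x', hx', hxu'⟩ := exists_rootPoly_polyOp_eq hA hu i
      set Q := polyOp A (rootPoly x') with hQ
      set z := ((betaProd A u i : ℝ) : 𝕜) • lanczosVec A u i with hz
      have hb0 : 0 ≤ beta A u i := beta_nonneg i
      have hbR : beta A u i ≤ R := beta_le hu i
      have e1 : ((D : ℝ) : 𝕜) • prevTerm A u (i + 1) = ((beta A u i ^ 2 : ℝ) : 𝕜) • z := by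
        rw [prevTerm, hz, hD, betaProd_succ]
        push_cast
        module
      have e2 : P u = P (u - u') + w' := by rw [map_sub, hxu]; abel
      have e3 : inner 𝕜 z w' = inner 𝕜 (Q (u - u')) w' := by
        have h1 : Q u' ∈ krylovLT A u' (i + 1) := by
          have := polyOp_mem_krylovLT_succ (A := A) (u := u') (monic_rootPoly x')
          rwa [natDegree_rootPoly] at this
        have h2 : inner 𝕜 (Q u') w' = 0 := by
          rw [hw', inner_smul_right, inner_eq_zero_of_mem_krylovLT h1, mul_zero]
        rw [map_sub, inner_sub_left, h2, sub_zero, hxu']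
      have hzn : ‖z‖ = betaProd A u i := norm_betaProd_smul hu i
      have hw'n : ‖w'‖ = D' := norm_betaProd_smul hu' (i + 1)
      have hQle : ‖Q (u - u')‖ ≤ (2 * R) ^ i * ‖u - u'‖ := norm_polyOp_rootPoly_le hA hx' _
      have hDi : betaProd A u i * beta A u i = D := (betaProd_succ i).symm
      have hin : ‖inner 𝕜 z (P u)‖ ≤
          betaProd A u i * (M * ‖u - u'‖) + (2 * R) ^ i * ‖u - u'‖ * D' := by
        rw [e2, inner_add_right, e3]
        refine (norm_add_le _ _).trans (add_le_add ?_ ?_)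
        · refine (norm_inner_le_norm _ _).trans ?_
          rw [hzn]
          exact mul_le_mul_of_nonneg_left (hPle _) (betaProd_nonneg i)
        · refine (norm_inner_le_norm _ _).trans ?_
          rw [hw'n]
          exact mul_le_mul_of_nonneg_right hQle hD0'
      rw [e1, inner_smul_left, norm_mul, RCLike.norm_conj, RCLike.norm_ofReal,
        abs_of_nonneg (sq_nonneg _)]
      have hMi : M = 2 * R * (2 * R) ^ i := by rw [hM, pow_succ]; ring
      calc beta A u i ^ 2 * ‖inner 𝕜 z (P u)‖
          ≤ beta A u i ^ 2 *
            (betaProd A u i * (M * ‖u - u'‖) + (2 * R) ^ i * ‖u - u'‖ * D') := by gcongr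
        _ = beta A u i * (betaProd A u i * beta A u i) * M * ‖u - u'‖ +
            beta A u i ^ 2 * ((2 * R) ^ i * ‖u - u'‖ * D') := by ring
        _ ≤ R * D * M * ‖u - u'‖ + R ^ 2 * ((2 * R) ^ i * ‖u - u'‖ * D') := by
            rw [hDi]; gcongr
        _ = R * M * ‖u - u'‖ * (D + D' / 2) := by rw [hMi]; ring
  have e4 : w' = P u + P (u' - u) := by rw [← hxu, ← map_add, add_sub_cancel]
  have e5 : inner 𝕜 y (P u) = inner 𝕜 (((D : ℝ) : 𝕜) • prevTerm A u j) (P u) := by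
    rw [hy2, inner_add_left, hlead, zero_add]
  rw [e4, inner_add_right, e5]
  calc _ ≤ R * M * ‖u - u'‖ * (D + D' / 2) + D * R * (M * ‖u - u'‖) := by
        refine (norm_add_le _ _).trans (add_le_add hprev ?_)
        refine (norm_inner_le_norm _ _).trans ?_
        refine mul_le_mul hyn ?_ (norm_nonneg _) (by positivity)
        rw [← hdist]
        exact hPle _
    _ = _ := by ring

/-- The vectors `betaProd j • v_j` for two starting vectors have a large inner product. -/
theorem sq_sub_le_norm_inner (hA : A.IsHermitian) (hu : ‖u‖ = 1) (hu' : ‖u'‖ = 1) (j : ℕ) :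
    betaProd A u j ^ 2 - betaProd A u j * ((2 * specNorm A) ^ j * ‖u - u'‖) ≤
      ‖inner 𝕜 (((betaProd A u j : ℝ) : 𝕜) • lanczosVec A u j)
        (((betaProd A u' j : ℝ) : 𝕜) • lanczosVec A u' j)‖ := by
  obtain ⟨x, hx, hxu⟩ := exists_rootPoly_polyOp_eq hA hu' j
  set D := betaProd A u j with hD
  set w := ((D : ℝ) : 𝕜) • lanczosVec A u j with hw
  set P := polyOp A (rootPoly x) with hP
  have hwn : ‖w‖ = D := norm_betaProd_smul hu j
  have h1 : inner 𝕜 w (P u - w) = 0 := by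
    rw [← inner_conj_symm, hw, inner_smul_right, inner_eq_zero_of_mem_krylovLT
      (polyOp_sub_mem hA hu (monic_rootPoly x) (natDegree_rootPoly x))]
    simp
  have e : ((betaProd A u' j : ℝ) : 𝕜) • lanczosVec A u' j = w + (P u - w) + P (u' - u) := by
    rw [← hxu, map_sub]; abel
  rw [e, inner_add_right, inner_add_right, h1, add_zero, inner_self_eq_norm_sq_to_K, hwn]
  have h2 : ‖inner 𝕜 w (P (u' - u))‖ ≤ D * ((2 * specNorm A) ^ j * ‖u - u'‖) := by
    refine (norm_inner_le_norm _ _).trans ?_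
    rw [hwn, norm_sub_rev u u']
    exact mul_le_mul_of_nonneg_left (norm_polyOp_rootPoly_le hA hx _) (betaProd_nonneg j)
  have h3 := norm_sub_le_norm_add (((D : ℝ) : 𝕜) ^ 2) (inner 𝕜 w (P (u' - u)))
  have h4 : ‖((D : ℝ) : 𝕜) ^ 2‖ = D ^ 2 := by
    rw [norm_pow, RCLike.norm_ofReal, sq_abs]
  rw [h4] at h3
  linarith

theorem abs_alpha_sub_mul_le_of_le (hA : A.IsHermitian) (hu : ‖u‖ = 1) (hu' : ‖u'‖ = 1) {j : ℕ}
    (hle : betaProd A u' j ≤ betaProd A u j) (hpos : 0 < betaProd A u j) :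
    |alpha A u j - alpha A u' j| * betaProd A u j ≤
      7 * specNorm A * (2 * specNorm A) ^ j * ‖u - u'‖ := by
  have hR := specNorm_nonneg A
  set R := specNorm A with hRdef
  set D := betaProd A u j with hD
  set D' := betaProd A u' j with hD'
  set M := (2 * R) ^ j with hM
  have hM0 : 0 ≤ M := by positivity
  have hD0' : 0 ≤ D' := betaProd_nonneg j
  set w := ((D : ℝ) : 𝕜) • lanczosVec A u j with hw
  set w' := ((D' : ℝ) : 𝕜) • lanczosVec A u' j with hw'
  set δ := |alpha A u j - alpha A u' j| with hδ
  set q := M * ‖u - u'‖ with hq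
  have hq0 : 0 ≤ q := by positivity
  have hδ2 : δ ≤ 2 * R := by
    have h1 := abs_sub (alpha A u j) (alpha A u' j)
    have h2 := abs_alpha_le (A := A) hu j
    have h3 := abs_alpha_le (A := A) hu' j
    linarith
  have h1 : ‖inner 𝕜 (op A w - ((alpha A u j : ℝ) : 𝕜) • w) w'‖ ≤ R * q * (2 * D + D' / 2) := by
    refine (norm_inner_op_sub_le hA hu hu' j).trans (le_of_eq ?_)
    rw [hq]; ring
  have h2 : ‖inner 𝕜 w (op A w' - ((alpha A u' j : ℝ) : 𝕜) • w')‖ ≤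
      R * q * (2 * D' + D / 2) := by
    rw [norm_inner_symm]
    refine (norm_inner_op_sub_le hA hu' hu j).trans (le_of_eq ?_)
    rw [hq, norm_sub_rev]; ring
  have e : inner 𝕜 (op A w - ((alpha A u j : ℝ) : 𝕜) • w) w' -
      inner 𝕜 w (op A w' - ((alpha A u' j : ℝ) : 𝕜) • w') =
      ((alpha A u' j - alpha A u j : ℝ) : 𝕜) * inner 𝕜 w w' := by
    rw [inner_sub_left, inner_sub_right, inner_op_left hA, inner_smul_left w w', inner_smul_right w w',
      RCLike.conj_ofReal, RCLike.ofReal_sub]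
    ring
  have h3 : δ * ‖inner 𝕜 w w'‖ ≤ R * q * (5 * D) := by
    have h4 : ‖((alpha A u' j - alpha A u j : ℝ) : 𝕜) * inner 𝕜 w w'‖ = δ * ‖inner 𝕜 w w'‖ := by
      rw [norm_mul, RCLike.norm_ofReal, hδ, abs_sub_comm]
    rw [← h4, ← e]
    refine (norm_sub_le _ _).trans ((add_le_add h1 h2).trans ?_)
    rw [← mul_add]
    refine mul_le_mul_of_nonneg_left ?_ (by positivity)
    linarith
  have h5 : D ^ 2 - D * q ≤ ‖inner 𝕜 w w'‖ := sq_sub_le_norm_inner hA hu hu' j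
  have hδ0 : 0 ≤ δ := abs_nonneg _
  have goal : δ * D ≤ 7 * R * q := by
    -- if `q` is not small compared with `D`, the trivial bound `2 R` suffices
    rcases le_or_gt (7 * q) (2 * D) with hcase | hcase
    · have h6 : δ * (D ^ 2 - D * q) ≤ R * q * (5 * D) :=
        (mul_le_mul_of_nonneg_left h5 hδ0).trans h3
      have h7 : D * (δ * (D - q)) ≤ D * (5 * R * q) := by linarith
      have h8 : δ * (D - q) ≤ 5 * R * q := le_of_mul_le_mul_left h7 hpos
      nlinarith
    · nlinarith
  calc δ * D ≤ 7 * R * q := goal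
    _ = _ := by rw [hq]; ring

/-- The coefficient `α_j` is Lipschitz where `betaProd j` is bounded below. -/
theorem abs_alpha_sub_mul_le (hA : A.IsHermitian) (hu : ‖u‖ = 1) (hu' : ‖u'‖ = 1) {j : ℕ}
    {D₀ : ℝ} (hD₀ : 0 < D₀) (h : D₀ ≤ betaProd A u j) (h' : D₀ ≤ betaProd A u' j) :
    |alpha A u j - alpha A u' j| * D₀ ≤
      7 * specNorm A * (2 * specNorm A) ^ j * ‖u - u'‖ := by
  rcases le_total (betaProd A u' j) (betaProd A u j) with hle | hle
  · refine le_trans ?_ (abs_alpha_sub_mul_le_of_le hA hu hu' hle (hD₀.trans_le h))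
    gcongr
  · rw [abs_sub_comm, norm_sub_rev]
    refine le_trans ?_ (abs_alpha_sub_mul_le_of_le hA hu' hu hle (hD₀.trans_le h'))
    gcongr

end Lanczos

/-! ### Second moments of the uniform measure on the sphere -/

namespace Lanczos

open scoped Pointwise

theorem norm_sphere {n : ℕ} (u : Sphere n) : ‖(u : EuclideanSpace ℝ (Fin n))‖ = 1 :=
  mem_sphere_zero_iff_norm.1 u.2

/-- The action of a linear isometry on the sphere. -/
def sphereMap {n : ℕ} (e : EuclideanSpace ℝ (Fin n) ≃ₗᵢ[ℝ] EuclideanSpace ℝ (Fin n))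
    (u : Sphere n) : Sphere n :=
  ⟨e u, by rw [mem_sphere_zero_iff_norm, e.norm_map, norm_sphere]⟩

theorem continuous_sphereMap {n : ℕ}
    (e : EuclideanSpace ℝ (Fin n) ≃ₗᵢ[ℝ] EuclideanSpace ℝ (Fin n)) :
    Continuous (sphereMap e) :=
  (e.continuous.comp continuous_subtype_val).subtype_mk _

theorem measurePreserving_sphereMap {n : ℕ} (hn : n ≠ 0)
    (e : EuclideanSpace ℝ (Fin n) ≃ₗᵢ[ℝ] EuclideanSpace ℝ (Fin n)) :
    MeasurePreserving (sphereMap e) (unifSphere n) (unifSphere n) := by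
  have hm : Measurable (sphereMap e) := (continuous_sphereMap e).measurable
  refine ⟨hm, ?_⟩
  ext s hs
  rw [Measure.map_apply hm hs, unifSphere_apply hn hs, unifSphere_apply hn (hm hs)]
  congr 1
  have hcone : Set.Ioo (0 : ℝ) 1 • ((↑) '' (sphereMap e ⁻¹' s) : Set (EuclideanSpace ℝ (Fin n))) =
      e ⁻¹' (Set.Ioo (0 : ℝ) 1 • ((↑) '' s : Set (EuclideanSpace ℝ (Fin n)))) := by
    ext x
    constructor
    · rintro ⟨r, hr, _, ⟨a, ha, rfl⟩, rfl⟩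
      exact ⟨r, hr, _, ⟨sphereMap e a, ha, rfl⟩, by simp [sphereMap]⟩
    · rintro ⟨r, hr, _, ⟨a, ha, rfl⟩, hx⟩
      refine ⟨r, hr, _, ⟨sphereMap e.symm a, ?_, rfl⟩, ?_⟩
      · have : sphereMap e (sphereMap e.symm a) = a := by
          apply Subtype.ext
          simp [sphereMap]
        rw [Set.mem_preimage, this]
        exact ha
      · apply e.injective
        simp only [sphereMap, map_smul, LinearIsometryEquiv.apply_symm_apply]
        exact hx
  rw [hcone]
  exact e.measurePreserving.measure_preimage (measurableSet_Ioo_smul_sphere hs).nullMeasurableSet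

theorem integrable_unifSphere {n : ℕ} {f : Sphere n → ℝ} (hf : Continuous f) :
    Integrable f (unifSphere n) :=
  hf.integrable_of_hasCompactSupport (HasCompactSupport.of_compactSpace f)

theorem continuous_inner_sphere_sq {n : ℕ} (x : EuclideanSpace ℝ (Fin n)) :
    Continuous fun u : Sphere n => inner ℝ x (u : EuclideanSpace ℝ (Fin n)) ^ 2 :=
  (continuous_const.inner continuous_subtype_val).pow 2

/-- By rotation invariance, the second moment of a coordinate does not depend on the direction. -/
theorem integral_inner_sq {n : ℕ} (hn : n ≠ 0) (x : EuclideanSpace ℝ (Fin n)) :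
    ∫ u : Sphere n, inner ℝ x (u : EuclideanSpace ℝ (Fin n)) ^ 2 ∂unifSphere n =
      ‖x‖ ^ 2 / n := by
  have := isProbabilityMeasure_unifSphere hn
  have hrot : ∀ y z : EuclideanSpace ℝ (Fin n), ‖y‖ = ‖z‖ →
      ∫ u : Sphere n, inner ℝ y (u : EuclideanSpace ℝ (Fin n)) ^ 2 ∂unifSphere n =
        ∫ u : Sphere n, inner ℝ z (u : EuclideanSpace ℝ (Fin n)) ^ 2 ∂unifSphere n := by
    intro y z hyz
    set e := (Submodule.span ℝ {y - z})ᗮ.reflection with he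
    have hey : e y = z := Submodule.reflection_sub hyz
    have hmp := measurePreserving_sphereMap hn e
    have h1 := integral_map (μ := unifSphere n) (φ := sphereMap e) hmp.measurable.aemeasurable
      (f := fun u : Sphere n => inner ℝ z (u : EuclideanSpace ℝ (Fin n)) ^ 2)
      (continuous_inner_sphere_sq z).aestronglyMeasurable
    rw [hmp.map_eq] at h1
    rw [h1]
    congr with u
    rw [← hey]
    simp [sphereMap]
  have hcoord : ∀ a : Fin n,
      ∫ u : Sphere n, inner ℝ x (u : EuclideanSpace ℝ (Fin n)) ^ 2 ∂unifSphere n =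
        ‖x‖ ^ 2 * ∫ u : Sphere n, (u : EuclideanSpace ℝ (Fin n)) a ^ 2 ∂unifSphere n := by
    intro a
    rw [hrot x (‖x‖ • EuclideanSpace.single a (1 : ℝ)) (by simp [norm_smul]),
      ← integral_const_mul]
    congr with u
    simp [inner_smul_left, mul_pow, EuclideanSpace.inner_single_left]
  have hsum : ∑ a : Fin n, ∫ u : Sphere n, (u : EuclideanSpace ℝ (Fin n)) a ^ 2 ∂unifSphere n
      = 1 := by
    rw [← integral_finsetSum]
    · have : ∀ u : Sphere n, ∑ a : Fin n, (u : EuclideanSpace ℝ (Fin n)) a ^ 2 = 1 := by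
        intro u
        have := EuclideanSpace.real_norm_sq_eq (u : EuclideanSpace ℝ (Fin n))
        rw [norm_sphere, one_pow] at this
        exact this.symm
      simp [this]
    · intro a _
      have h := continuous_inner_sphere_sq (n := n) (EuclideanSpace.single a (1 : ℝ))
      simpa [EuclideanSpace.inner_single_left] using integrable_unifSphere h
  have hall : (n : ℝ) * ∫ u : Sphere n, inner ℝ x (u : EuclideanSpace ℝ (Fin n)) ^ 2 ∂unifSphere n
      = ‖x‖ ^ 2 := by
    calc _ = ∑ _a : Fin n,
        ∫ u : Sphere n, inner ℝ x (u : EuclideanSpace ℝ (Fin n)) ^ 2 ∂unifSphere n := by simp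
      _ = ∑ a : Fin n,
        ‖x‖ ^ 2 * ∫ u : Sphere n, (u : EuclideanSpace ℝ (Fin n)) a ^ 2 ∂unifSphere n :=
          Finset.sum_congr rfl fun a _ => hcoord a
      _ = _ := by rw [← Finset.mul_sum, hsum, mul_one]
  rw [eq_div_iff (by exact_mod_cast hn), mul_comm]
  exact hall

/-! ### Mass of a random vector on a set of eigenvectors -/

section

variable {𝕜 : Type*} [RCLike 𝕜] {n : ℕ}

theorem toField_sub (x y : EuclideanSpace ℝ (Fin n)) :
    toField 𝕜 (x - y) = toField 𝕜 x - toField 𝕜 y := by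
  ext i
  simp [toField]

theorem norm_toField (x : EuclideanSpace ℝ (Fin n)) : ‖toField 𝕜 x‖ = ‖x‖ := by
  simp [EuclideanSpace.norm_eq, toField]

theorem norm_toField_sphere (u : Sphere n) :
    ‖toField 𝕜 (u : EuclideanSpace ℝ (Fin n))‖ = 1 := by
  rw [norm_toField, norm_sphere]

theorem norm_toField_sub (u u' : Sphere n) :
    ‖toField 𝕜 (u : EuclideanSpace ℝ (Fin n)) - toField 𝕜 (u' : EuclideanSpace ℝ (Fin n))‖ =
      dist u u' := by
  rw [← toField_sub, norm_toField, Subtype.dist_eq, dist_eq_norm]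

theorem norm_inner_toField_sq (e : EuclideanSpace 𝕜 (Fin n)) (x : EuclideanSpace ℝ (Fin n)) :
    ‖inner 𝕜 e (toField 𝕜 x)‖ ^ 2 =
      inner ℝ (WithLp.toLp 2 fun a => RCLike.re (e a)) x ^ 2 +
        inner ℝ (WithLp.toLp 2 fun a => RCLike.im (e a)) x ^ 2 := by
  rw [RCLike.norm_sq_eq_def]
  simp [PiLp.inner_apply, toField, ← sq, mul_comm]

theorem continuous_norm_inner_toField_sq (e : EuclideanSpace 𝕜 (Fin n)) :
    Continuous fun u : Sphere n => ‖inner 𝕜 e (toField 𝕜 (u : EuclideanSpace ℝ (Fin n)))‖ ^ 2 := by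
  simp_rw [norm_inner_toField_sq]
  exact (continuous_inner_sphere_sq _).add (continuous_inner_sphere_sq _)

theorem integral_norm_inner_toField_sq (hn : n ≠ 0) (e : EuclideanSpace 𝕜 (Fin n)) :
    ∫ u : Sphere n, ‖inner 𝕜 e (toField 𝕜 (u : EuclideanSpace ℝ (Fin n)))‖ ^ 2 ∂unifSphere n =
      ‖e‖ ^ 2 / n := by
  simp_rw [norm_inner_toField_sq]
  rw [integral_add (integrable_unifSphere (continuous_inner_sphere_sq _))
    (integrable_unifSphere (continuous_inner_sphere_sq _)), integral_inner_sq hn,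
    integral_inner_sq hn, ← add_div]
  congr 1
  rw [EuclideanSpace.real_norm_sq_eq, EuclideanSpace.real_norm_sq_eq, EuclideanSpace.norm_sq_eq,
    ← Finset.sum_add_distrib]
  refine Finset.sum_congr rfl fun a _ => ?_
  rw [RCLike.norm_sq_eq_def]
  simp [sq]

/-- The square root of the mass `∑_{i ∈ S} |⟨e_i, x⟩|²` is `1`-Lipschitz. -/
theorem sqrt_sum_norm_inner_sq_le (e : OrthonormalBasis (Fin n) 𝕜 (EuclideanSpace 𝕜 (Fin n)))
    (S : Finset (Fin n)) (x y : EuclideanSpace 𝕜 (Fin n)) :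
    √(∑ i ∈ S, ‖inner 𝕜 (e i) x‖ ^ 2) ≤ √(∑ i ∈ S, ‖inner 𝕜 (e i) y‖ ^ 2) + ‖x - y‖ := by
  let L : EuclideanSpace 𝕜 (Fin n) → EuclideanSpace 𝕜 S := fun x =>
    WithLp.toLp 2 fun i => inner 𝕜 (e i) x
  have hL : ∀ x, √(∑ i ∈ S, ‖inner 𝕜 (e i) x‖ ^ 2) = ‖L x‖ := by
    intro x
    rw [EuclideanSpace.norm_eq]
    congr 1
    exact (Finset.sum_coe_sort S fun i => ‖inner 𝕜 (e i) x‖ ^ 2).symm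
  have hsub : L x = L y + L (x - y) := by
    ext i
    simp [L, inner_sub_right]
  have hle : ‖L (x - y)‖ ≤ ‖x - y‖ := by
    rw [← hL]
    refine Real.sqrt_le_iff.2 ⟨norm_nonneg _, ?_⟩
    exact e.orthonormal.sum_inner_products_le (x - y)
  rw [hL, hL, hsub]
  exact (norm_add_le _ _).trans (add_le_add le_rfl hle)

/-- A random unit vector is unlikely to put less than `0.36 δ` of its mass on a set of `δ n`
vectors of an orthonormal basis: its mass there has mean at least `δ`, so it exceeds `0.81 δ` with
probability at least `0.19 δ`, and the two events are far apart. -/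
theorem unifSphere_sum_norm_inner_sq_lt (hn : n ≠ 0)
    (e : OrthonormalBasis (Fin n) 𝕜 (EuclideanSpace 𝕜 (Fin n))) (S : Finset (Fin n)) {δ : ℝ}
    (hδ : 0 < δ) (hS : δ * n ≤ S.card) :
    (unifSphere n).real {u | ∑ i ∈ S,
        ‖inner 𝕜 (e i) (toField 𝕜 (u : EuclideanSpace ℝ (Fin n)))‖ ^ 2 < 0.36 * δ} ≤
      Real.exp (-(0.0225 * (n * δ))) / (0.19 * δ) := by
  have := isProbabilityMeasure_unifSphere hn
  set g : Sphere n → ℝ := fun u => ∑ i ∈ S,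
        ‖inner 𝕜 (e i) (toField 𝕜 (u : EuclideanSpace ℝ (Fin n)))‖ ^ 2 with hg
  have hgc : Continuous g := continuous_finsetSum _ fun i _ => continuous_norm_inner_toField_sq _
  have hg1 : ∀ u, g u ≤ 1 := by
    intro u
    have := e.orthonormal.sum_inner_products_le (s := S)
      (toField 𝕜 (u : EuclideanSpace ℝ (Fin n)))
    rwa [norm_toField_sphere, one_pow] at this
  have hn' : (0 : ℝ) < n := by exact_mod_cast Nat.pos_of_ne_zero hn
  have hint : δ ≤ ∫ u, g u ∂unifSphere n := by
    rw [hg, integral_finsetSum _ fun i _ =>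
      integrable_unifSphere (continuous_norm_inner_toField_sq _)]
    simp_rw [integral_norm_inner_toField_sq hn, e.norm_eq_one]
    rw [Finset.sum_const, nsmul_eq_mul, one_pow, mul_one_div, le_div_iff₀ hn']
    exact hS
  set C := {u | 0.81 * δ ≤ g u} with hC
  have hCm : MeasurableSet C := measurableSet_le measurable_const hgc.measurable
  have hCP : 0.19 * δ ≤ (unifSphere n).real C := by
    have h1 : ∫ u, g u ∂unifSphere n ≤
        ∫ u, (0.81 * δ + C.indicator (fun _ => (1 : ℝ)) u) ∂unifSphere n := by
      refine integral_mono (integrable_unifSphere hgc)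
        ((integrable_const _).add ((integrable_const _).indicator hCm)) fun u => ?_
      by_cases hu : u ∈ C
      · simp only [Set.indicator_of_mem hu]
        linarith [hg1 u]
      · simp only [Set.indicator_of_notMem hu]
        have : g u < 0.81 * δ := not_le.1 hu
        linarith
    rw [integral_add (integrable_const _) ((integrable_const _).indicator hCm),
      integral_indicator hCm] at h1
    simp at h1
    linarith
  have hdist : ∀ x ∈ {u | g u < 0.36 * δ}, ∀ y ∈ C, 0.3 * √δ ≤ dist x y := by
    intro x hx y hy
    have h1 := sqrt_sum_norm_inner_sq_le e S (toField 𝕜 (y : EuclideanSpace ℝ (Fin n)))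
      (toField 𝕜 (x : EuclideanSpace ℝ (Fin n)))
    rw [norm_toField_sub, dist_comm] at h1
    have h2 : √(g x) ≤ 0.6 * √δ := by
      rw [show 0.6 * √δ = √(0.36 * δ) by
        rw [Real.sqrt_mul (by norm_num), show (0.36 : ℝ) = 0.6 ^ 2 by norm_num,
          Real.sqrt_sq (by norm_num)]]
      exact Real.sqrt_le_sqrt (le_of_lt hx)
    have h3 : 0.9 * √δ ≤ √(g y) := by
      rw [show 0.9 * √δ = √(0.81 * δ) by
        rw [Real.sqrt_mul (by norm_num), show (0.81 : ℝ) = 0.9 ^ 2 by norm_num,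
          Real.sqrt_sq (by norm_num)]]
      exact Real.sqrt_le_sqrt hy
    have h4 : √(g y) ≤ √(g x) + dist x y := h1
    linarith
  have hmain := unifSphere_mul_unifSphere_le hn (by positivity) hdist
  rw [le_div_iff₀ (by positivity)]
  calc _ ≤ (unifSphere n).real {u | g u < 0.36 * δ} * (unifSphere n).real C := by gcongr
    _ ≤ _ := hmain
    _ = _ := by
      congr 1
      rw [mul_pow, Real.sq_sqrt hδ.le]
      ring

end

end Lanczos

/-! ### A lower bound for the norms of the orthogonal polynomials -/

namespace Lanczos

/-- Equidistribution bounds a monic polynomial with distinct roots from below at many members of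
the family. -/
theorem IsEquidistributed.exists_finset {n : ℕ} {Λ : Fin n → ℝ} {δ ω : ℝ} {k : ℕ}
    (h : IsEquidistributed Λ δ ω k) (hω : 0 < ω) {m : ℕ} (hm : 0 < m) (hmk : m ≤ k)
    {t : Fin m → ℝ} (ht : Function.Injective t) :
    ∃ S : Finset (Fin n), δ * n ≤ S.card ∧ ∀ i ∈ S, ω ^ m ≤ |(rootPoly t).eval (Λ i)| := by
  set T := Finset.univ.image t with hT
  have hcard : T.card = m := by rw [hT, Finset.card_image_of_injective _ ht]; simp
  have hne : T.Nonempty := by rw [← Finset.card_pos, hcard]; exact hm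
  have h1 := h T hne (by rw [hcard]; exact hmk)
  rw [hcard] at h1
  set s := {i : Fin n | Λ i ∉ T ∧
    Real.log ω ≤ (1 / (m : ℝ)) * ∑ t ∈ T, Real.log |Λ i - t|} with hs
  have hfin : s.Finite := Set.toFinite s
  refine ⟨hfin.toFinset, by rwa [← Set.ncard_eq_toFinset_card s hfin], fun i hi => ?_⟩
  obtain ⟨hi1, hi2⟩ := (hfin.mem_toFinset).1 hi
  have hm' : (0 : ℝ) < m := by exact_mod_cast hm
  have hne0 : ∀ r, Λ i - t r ≠ 0 := by
    intro r h0
    exact hi1 (Finset.mem_image.2 ⟨r, Finset.mem_univ _, (sub_eq_zero.1 h0).symm⟩)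
  have hsum : ∑ x ∈ T, Real.log |Λ i - x| = ∑ r, Real.log |Λ i - t r| := by
    rw [hT, Finset.sum_image fun a _ b _ hab => ht hab]
  rw [hsum, ← Real.log_prod fun r _ => abs_ne_zero.2 (hne0 r), ← Finset.abs_prod,
    ← eval_rootPoly, one_div, ← div_eq_inv_mul, le_div_iff₀ hm', mul_comm, ← Real.log_pow] at hi2
  have hpos : 0 < |(rootPoly t).eval (Λ i)| := by
    rw [eval_rootPoly, Finset.abs_prod]
    exact Finset.prod_pos fun r _ => abs_pos.2 (hne0 r)
  exact (Real.log_le_log_iff (by positivity) hpos).1 hi2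

/-- The point of `[-R, R]` used to approximate the `r`-th root: the grid of mesh `2 R / n` is
shifted by the fraction `r / m` of its mesh, so that different roots are never approximated by the
same point. -/
def gridPoint (R : ℝ) (n : ℕ) {m : ℕ} (f : Fin m → Fin n) (r : Fin m) : ℝ :=
  -R + 2 * R / n * ((f r : ℕ) + (r : ℕ) / (m : ℝ))

theorem fin_div_lt_one {m : ℕ} (r : Fin m) : ((r : ℕ) : ℝ) / m < 1 := by
  have hm : (0 : ℝ) < m := by exact_mod_cast r.pos
  rw [div_lt_one hm]
  exact_mod_cast r.2

theorem gridPoint_injective {R : ℝ} (hR : 0 < R) {n : ℕ} (hn : n ≠ 0) {m : ℕ}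
    (f : Fin m → Fin n) : Function.Injective (gridPoint R n f) := by
  intro r s hrs
  have hn' : (0 : ℝ) < n := by exact_mod_cast Nat.pos_of_ne_zero hn
  have hm : (0 : ℝ) < m := by exact_mod_cast r.pos
  have h1 : ((f r : ℕ) : ℝ) + (r : ℕ) / (m : ℝ) = (f s : ℕ) + (s : ℕ) / (m : ℝ) := by
    have h2 : 2 * R / n ≠ 0 := by positivity
    exact mul_left_cancel₀ h2 (add_left_cancel hrs)
  have hr0 : 0 ≤ ((r : ℕ) : ℝ) / m := by positivity
  have hs0 : 0 ≤ ((s : ℕ) : ℝ) / m := by positivity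
  have hr1 := fin_div_lt_one r
  have hs1 := fin_div_lt_one s
  have h3 : (f r : ℕ) = f s := by
    have h4 : ((f r : ℕ) : ℝ) < (f s : ℕ) + 1 := by linarith
    have h5 : ((f s : ℕ) : ℝ) < (f r : ℕ) + 1 := by linarith
    have h4' : (f r : ℕ) < f s + 1 := by exact_mod_cast h4
    have h5' : (f s : ℕ) < f r + 1 := by exact_mod_cast h5
    omega
  rw [h3] at h1
  have h6 := (div_left_inj' hm.ne').1 (add_left_cancel h1)
  exact Fin.ext (by exact_mod_cast h6)

theorem abs_gridPoint_le {R : ℝ} (hR : 0 < R) {n m : ℕ} (f : Fin m → Fin n) (r : Fin m) :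
    |gridPoint R n f r| ≤ R := by
  have hn' : (0 : ℝ) < n := by exact_mod_cast (f r).pos
  have hr0 : 0 ≤ ((r : ℕ) : ℝ) / m := by positivity
  have hr1 := fin_div_lt_one r
  have hf : ((f r : ℕ) : ℝ) + 1 ≤ n := by exact_mod_cast (f r).2
  have h1 : 2 * R / n * ((f r : ℕ) + (r : ℕ) / (m : ℝ)) ≤ 2 * R := by
    rw [div_mul_eq_mul_div, div_le_iff₀ hn']
    refine mul_le_mul_of_nonneg_left ?_ (by positivity)
    linarith
  have h2 : 0 ≤ 2 * R / n * ((f r : ℕ) + (r : ℕ) / (m : ℝ)) := by positivity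
  rw [abs_le, gridPoint]
  constructor <;> linarith

theorem exists_gridPoint {R : ℝ} (hR : 0 < R) {n : ℕ} (hn : n ≠ 0) {m : ℕ} {x : Fin m → ℝ}
    (hx : ∀ r, |x r| ≤ R) :
    ∃ f : Fin m → Fin n, ∀ r, |x r - gridPoint R n f r| ≤ 2 * R / n := by
  have hn' : (0 : ℝ) < n := by exact_mod_cast Nat.pos_of_ne_zero hn
  have h1 : ∀ r, ∃ a : Fin n, ((a : ℕ) : ℝ) ≤ (x r + R) * n / (2 * R) ∧
      (x r + R) * n / (2 * R) ≤ (a : ℕ) + 1 := by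
    intro r
    obtain ⟨h2, h3⟩ := abs_le.1 (hx r)
    set y := (x r + R) * n / (2 * R) with hy
    have hy0 : 0 ≤ y := div_nonneg (mul_nonneg (by linarith) hn'.le) (by positivity)
    have hyn : y ≤ n := by
      rw [hy, div_le_iff₀ (by positivity), mul_comm (n : ℝ)]
      exact mul_le_mul_of_nonneg_right (by linarith) hn'.le
    rcases Nat.lt_or_ge ⌊y⌋₊ n with h | h
    · exact ⟨⟨⌊y⌋₊, h⟩, Nat.floor_le hy0, (Nat.lt_floor_add_one y).le⟩
    · have h4 : (n : ℝ) ≤ y := (Nat.cast_le.2 h).trans (Nat.floor_le hy0)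
      have e : ((n - 1 : ℕ) : ℝ) = n - 1 := by
        rw [Nat.cast_sub (Nat.one_le_iff_ne_zero.2 hn), Nat.cast_one]
      refine ⟨⟨n - 1, by omega⟩, ?_, ?_⟩
      · simp only [e]; linarith
      · simp only [e]; linarith
  choose f hf1 hf2 using h1
  refine ⟨f, fun r => ?_⟩
  have hr0 : 0 ≤ ((r : ℕ) : ℝ) / m := by positivity
  have hr1 := fin_div_lt_one r
  have e : x r - gridPoint R n f r =
      2 * R / n * ((x r + R) * n / (2 * R) - ((f r : ℕ) + (r : ℕ) / (m : ℝ))) := by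
    rw [gridPoint]
    field_simp
    ring
  rw [e, abs_mul, abs_of_pos (show 0 < 2 * R / n by positivity)]
  refine mul_le_of_le_one_right (by positivity) (abs_le.2 ⟨?_, ?_⟩)
  · linarith [hf1 r]
  · linarith [hf2 r]

theorem abs_prod_sub_prod_le {C ρ : ℝ} (hC : 0 ≤ C) : ∀ {m : ℕ} {a b : Fin m → ℝ},
    (∀ r, |a r| ≤ C) → (∀ r, |b r| ≤ C) → (∀ r, |a r - b r| ≤ C * ρ) →
    |∏ r, a r - ∏ r, b r| ≤ m * ρ * C ^ m := by
  intro m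
  induction m with
  | zero => intro a b _ _ _; simp
  | succ m ih =>
    intro a b ha hb hab
    have e : ∏ r, a r - ∏ r, b r = (a 0 - b 0) * ∏ r : Fin m, a r.succ +
        b 0 * (∏ r : Fin m, a r.succ - ∏ r : Fin m, b r.succ) := by
      rw [Fin.prod_univ_succ, Fin.prod_univ_succ]; ring
    have h1 : |∏ r : Fin m, a r.succ| ≤ C ^ m := by
      rw [Finset.abs_prod]
      refine (Finset.prod_le_prod (fun r _ => abs_nonneg _) fun r _ => ha r.succ).trans ?_
      simp
    have h2 := ih (a := fun r => a r.succ) (b := fun r => b r.succ) (fun r => ha _)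
      (fun r => hb _) fun r => hab _
    have hρ : 0 ≤ C * ρ := (abs_nonneg _).trans (hab 0)
    calc _ ≤ |a 0 - b 0| * |∏ r : Fin m, a r.succ| +
          |b 0| * |∏ r : Fin m, a r.succ - ∏ r : Fin m, b r.succ| := by
          rw [e, ← abs_mul, ← abs_mul]; exact abs_add_le _ _
      _ ≤ C * ρ * C ^ m + C * (m * ρ * C ^ m) := by
          gcongr
          · exact hab 0
          · exact hb 0
      _ = _ := by push_cast; ring

section

variable {𝕜 : Type*} [RCLike 𝕜] {n : ℕ} {A : Matrix (Fin n) (Fin n) 𝕜}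

theorem norm_polyOp_rootPoly_sub_le (hA : A.IsHermitian) (hn : n ≠ 0) {m : ℕ} {x t : Fin m → ℝ}
    (hx : ∀ r, |x r| ≤ specNorm A) (ht : ∀ r, |t r| ≤ specNorm A)
    (hxt : ∀ r, |x r - t r| ≤ 2 * specNorm A / n) (y : EuclideanSpace 𝕜 (Fin n)) :
    ‖polyOp A (rootPoly t) y - polyOp A (rootPoly x) y‖ ≤
      m * (2 * specNorm A) ^ m / n * ‖y‖ := by
  have hR := specNorm_nonneg A
  rw [← LinearMap.sub_apply, ← polyOp_sub]
  refine norm_polyOp_le hA (by positivity) (fun i => ?_) y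
  rw [Polynomial.eval_sub, eval_rootPoly, eval_rootPoly]
  have hb : ∀ z : ℝ, |z| ≤ specNorm A → |hA.eigenvalues i - z| ≤ 2 * specNorm A := by
    intro z hz
    have := abs_sub (hA.eigenvalues i) z
    linarith [abs_eigenvalues_le hA i]
  refine (abs_prod_sub_prod_le (C := 2 * specNorm A) (ρ := 1 / n) (by positivity)
    (fun r => hb _ (ht r)) (fun r => hb _ (hx r)) fun r => ?_).trans (le_of_eq (by ring))
  rw [sub_sub_sub_cancel_left, mul_one_div]
  exact hxt r

/-- With high probability all monic polynomials of degree `m` have norm at least `√δ ω ^ m / 2`: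
by a union bound over polynomials with roots in the grid. -/
theorem unifSphere_betaProd_lt (hA : A.IsHermitian) {δ ω : ℝ} {k : ℕ}
    (hequi : IsEquidistributed hA.eigenvalues δ ω k) (hδ : 0 < δ) (hω : 0 < ω) (hn : n ≠ 0)
    (hR : 0 < specNorm A) {m : ℕ} (hm : 0 < m) (hmk : m ≤ k)
    (herr : m * (2 * specNorm A) ^ m / n ≤ 0.1 * (√δ * ω ^ m)) :
    (unifSphere n).real {u | betaProd A (toField 𝕜 (u : EuclideanSpace ℝ (Fin n))) m <
        0.5 * (√δ * ω ^ m)} ≤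
      n ^ m * (Real.exp (-(0.0225 * (n * δ))) / (0.19 * δ)) := by
  have hS : ∀ f : Fin m → Fin n, ∃ S : Finset (Fin n), δ * n ≤ S.card ∧
      ∀ i ∈ S, ω ^ m ≤ |(rootPoly (gridPoint (specNorm A) n f)).eval (hA.eigenvalues i)| :=
    fun f => hequi.exists_finset hω hm hmk (gridPoint_injective hR hn f)
  choose S hS1 hS2 using hS
  set B : (Fin m → Fin n) → Set (Sphere n) := fun f => {u | ∑ i ∈ S f,
    ‖inner 𝕜 (hA.eigenvectorBasis i) (toField 𝕜 (u : EuclideanSpace ℝ (Fin n)))‖ ^ 2 <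
      0.36 * δ} with hB
  have hsub : {u : Sphere n | betaProd A (toField 𝕜 (u : EuclideanSpace ℝ (Fin n))) m <
        0.5 * (√δ * ω ^ m)} ⊆ ⋃ f, B f := by
    intro u hu
    by_contra hcon
    rw [Set.mem_ofPred_eq] at hu
    refine not_le.2 hu ?_
    set v := toField 𝕜 (u : EuclideanSpace ℝ (Fin n)) with hv
    have hv1 : ‖v‖ = 1 := norm_toField_sphere u
    obtain ⟨x, hx, hxv⟩ := exists_rootPoly_polyOp_eq hA hv1 m
    obtain ⟨f, hf⟩ := exists_gridPoint hR hn hx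
    have hfB : 0.36 * δ ≤ ∑ i ∈ S f, ‖inner 𝕜 (hA.eigenvectorBasis i) v‖ ^ 2 := by
      by_contra hlt
      exact hcon (Set.mem_iUnion.2 ⟨f, not_le.1 hlt⟩)
    set t := gridPoint (specNorm A) n f with ht
    have h1 : (0.6 * (√δ * ω ^ m)) ^ 2 ≤ ‖polyOp A (rootPoly t) v‖ ^ 2 := by
      rw [norm_polyOp_sq hA]
      calc (0.6 * (√δ * ω ^ m)) ^ 2 = (ω ^ m) ^ 2 * (0.36 * δ) := by
            rw [mul_pow, mul_pow, Real.sq_sqrt hδ.le]; ring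
        _ ≤ (ω ^ m) ^ 2 * ∑ i ∈ S f, ‖inner 𝕜 (hA.eigenvectorBasis i) v‖ ^ 2 := by gcongr
        _ ≤ ∑ i ∈ S f, (rootPoly t).eval (hA.eigenvalues i) ^ 2 *
              ‖inner 𝕜 (hA.eigenvectorBasis i) v‖ ^ 2 := by
            rw [Finset.mul_sum]
            refine Finset.sum_le_sum fun i hi => mul_le_mul_of_nonneg_right ?_ (sq_nonneg _)
            rw [← sq_abs ((rootPoly t).eval _)]
            have := hS2 f i hi
            gcongr
        _ ≤ _ := Finset.sum_le_univ_sum_of_nonneg fun i => by positivity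
    have h2 : 0.6 * (√δ * ω ^ m) ≤ ‖polyOp A (rootPoly t) v‖ :=
      (sq_le_sq₀ (by positivity) (norm_nonneg _)).1 h1
    have h3 := norm_polyOp_rootPoly_sub_le hA hn hx (fun r => abs_gridPoint_le hR f r) hf v
    rw [hv1, mul_one] at h3
    have h4 := norm_sub_norm_le (polyOp A (rootPoly t) v) (polyOp A (rootPoly x) v)
    rw [hxv, norm_betaProd_smul hv1] at h4
    rw [hxv] at h3
    linarith
  calc _ ≤ (unifSphere n).real (⋃ f, B f) := measureReal_mono hsub (measure_ne_top _ _)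
    _ ≤ ∑ f, (unifSphere n).real (B f) := measureReal_iUnion_fintype_le B
    _ ≤ ∑ _f : Fin m → Fin n, Real.exp (-(0.0225 * (n * δ))) / (0.19 * δ) :=
        Finset.sum_le_sum fun f _ =>
          unifSphere_sum_norm_inner_sq_lt hn hA.eigenvectorBasis (S f) hδ (hS1 f)
    _ = _ := by simp

end

end Lanczos

/-! ### Concentration of the Jacobi coefficients -/

namespace Lanczos

/-- **Lévy's lemma**, local form: a function that is Lipschitz on a set of measure at least `7 / 8`
is concentrated around its median there. -/
theorem unifSphere_abs_sub_median {n : ℕ} (hn : n ≠ 0) {Ω : Set (Sphere n)}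
    (hΩ : (unifSphere n).real Ωᶜ ≤ 1 / 8) {X : Sphere n → ℝ} {L : ℝ} (hL : 0 < L)
    (hX : ∀ u ∈ Ω, ∀ u' ∈ Ω, |X u - X u'| ≤ L * dist u u') {M : ℝ}
    (hM : IsMedian (unifSphere n) X M) {t : ℝ} (ht : 0 ≤ t) :
    (unifSphere n).real {u | u ∈ Ω ∧ t ≤ |X u - M|} ≤
      16 / 3 * Real.exp (-(n * (t / L) ^ 2 / 4)) := by
  have := isProbabilityMeasure_unifSphere hn
  set P := unifSphere n with hP
  have half : ∀ s : Set (Sphere n), 1 / 2 ≤ P s → 3 / 8 ≤ P.real (s ∩ Ω) := by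
    intro s hs
    have h1 : 1 / 2 ≤ P.real s := by
      have := ENNReal.toReal_mono (measure_ne_top P s) hs
      simpa [Measure.real] using this
    have h2 : P.real s ≤ P.real (s ∩ Ω) + P.real Ωᶜ := by
      refine (measureReal_mono ?_ (measure_ne_top _ _)).trans (measureReal_union_le _ _)
      intro x hx
      by_cases hxΩ : x ∈ Ω
      · exact Or.inl ⟨hx, hxΩ⟩
      · exact Or.inr hxΩ
    linarith
  have tail : ∀ B C : Set (Sphere n), 3 / 8 ≤ P.real (B ∩ Ω) →
      (∀ x ∈ B ∩ Ω, ∀ y ∈ C, t / L ≤ dist x y) →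
      P.real C ≤ 8 / 3 * Real.exp (-(n * (t / L) ^ 2 / 4)) := by
    intro B C hB hBC
    have h1 := unifSphere_mul_unifSphere_le hn (div_nonneg ht hL.le) hBC
    have h2 : 3 / 8 * P.real C ≤ P.real (B ∩ Ω) * P.real C :=
      mul_le_mul_of_nonneg_right hB measureReal_nonneg
    linarith
  have hup := tail {u | X u ≤ M} {u | u ∈ Ω ∧ t ≤ X u - M} (half _ hM.1) (by
    rintro x ⟨hx, hxΩ⟩ y ⟨hyΩ, hy⟩
    have hx' : X x ≤ M := hx
    have h := hX y hyΩ x hxΩ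
    rw [div_le_iff₀ hL, mul_comm, dist_comm]
    linarith [le_abs_self (X y - X x)])
  have hdown := tail {u | M ≤ X u} {u | u ∈ Ω ∧ t ≤ M - X u} (half _ hM.2) (by
    rintro x ⟨hx, hxΩ⟩ y ⟨hyΩ, hy⟩
    have hx' : M ≤ X x := hx
    have h := hX x hxΩ y hyΩ
    rw [div_le_iff₀ hL, mul_comm]
    linarith [le_abs_self (X x - X y)])
  have hsub : {u | u ∈ Ω ∧ t ≤ |X u - M|} ⊆
      {u | u ∈ Ω ∧ t ≤ X u - M} ∪ {u | u ∈ Ω ∧ t ≤ M - X u} := by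
    rintro u ⟨hu, h⟩
    rcases le_abs.1 h with h | h
    · exact Or.inl ⟨hu, h⟩
    · exact Or.inr ⟨hu, by linarith⟩
  have h1 := (measureReal_mono (μ := P) hsub (measure_ne_top _ _)).trans
    (measureReal_union_le _ _)
  linarith

section

variable {𝕜 : Type*} [RCLike 𝕜] {n : ℕ} {A : Matrix (Fin n) (Fin n) 𝕜}

theorem two_mul_pow_mul_pow_le {R : ℝ} (hR : 0 ≤ R) {j m : ℕ} (hj : j ≤ m) :
    (2 * R) ^ j * R ^ (m - j) ≤ (2 * R) ^ m := by
  calc (2 * R) ^ j * R ^ (m - j) ≤ (2 * R) ^ j * (2 * R) ^ (m - j) := by gcongr; linarith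
    _ = (2 * R) ^ m := by rw [← pow_add, Nat.add_sub_cancel' hj]

theorem abs_alphaCoeff_sub_le (hA : A.IsHermitian) (hR : 0 < specNorm A) {m j : ℕ} (hj : j ≤ m)
    {D : ℝ} (hD : 0 < D) {u u' : Sphere n}
    (hu : D ≤ betaProd A (toField 𝕜 (u : EuclideanSpace ℝ (Fin n))) m)
    (hu' : D ≤ betaProd A (toField 𝕜 (u' : EuclideanSpace ℝ (Fin n))) m) :
    |alphaCoeff A u j - alphaCoeff A u' j| ≤
      7 * (specNorm A * (2 * specNorm A) ^ m / D) * dist u u' := by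
  have h1 := norm_toField_sphere (𝕜 := 𝕜) u
  have h2 := norm_toField_sphere (𝕜 := 𝕜) u'
  set R := specNorm A with hRdef
  have hRp : 0 < R ^ (m - j) := by positivity
  have h3 : D / R ^ (m - j) ≤ betaProd A (toField 𝕜 (u : EuclideanSpace ℝ (Fin n))) j := by
    rw [div_le_iff₀ hRp]; exact hu.trans (betaProd_le_mul_pow h1 hj)
  have h4 : D / R ^ (m - j) ≤ betaProd A (toField 𝕜 (u' : EuclideanSpace ℝ (Fin n))) j := by
    rw [div_le_iff₀ hRp]; exact hu'.trans (betaProd_le_mul_pow h2 hj)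
  have h5 := abs_alpha_sub_mul_le hA h1 h2 (by positivity) h3 h4
  rw [norm_toField_sub, mul_div_assoc', div_le_iff₀ hRp] at h5
  have h6 : |alphaCoeff A u j - alphaCoeff A u' j| * D ≤ 7 * R * (2 * R) ^ m * dist u u' := by
    refine h5.trans ?_
    calc 7 * R * (2 * R) ^ j * dist u u' * R ^ (m - j)
        = 7 * R * ((2 * R) ^ j * R ^ (m - j)) * dist u u' := by ring
      _ ≤ _ := by
        have := two_mul_pow_mul_pow_le hR.le hj
        gcongr
  rw [← le_div_iff₀ hD] at h6
  refine h6.trans (le_of_eq ?_)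
  ring

theorem abs_betaCoeff_sub_le (hA : A.IsHermitian) (hR : 0 < specNorm A) {m j : ℕ} (hj : j < m)
    {D : ℝ} (hD : 0 < D) {u u' : Sphere n}
    (hu : D ≤ betaProd A (toField 𝕜 (u : EuclideanSpace ℝ (Fin n))) m) :
    |betaCoeff A u j - betaCoeff A u' j| ≤
      3.5 * (specNorm A * (2 * specNorm A) ^ m / D) * dist u u' := by
  have h1 := norm_toField_sphere (𝕜 := 𝕜) u
  have h2 := norm_toField_sphere (𝕜 := 𝕜) u'
  set R := specNorm A with hRdef
  have hRp : 0 < R ^ (m - j) := by positivity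
  have h3 : D / R ^ (m - j) ≤ betaProd A (toField 𝕜 (u : EuclideanSpace ℝ (Fin n))) j := by
    rw [div_le_iff₀ hRp]; exact hu.trans (betaProd_le_mul_pow h1 hj.le)
  have h5 := (mul_le_mul_of_nonneg_left h3 (abs_nonneg _)).trans (abs_beta_sub_mul_le hA h1 h2 j)
  rw [norm_toField_sub, mul_div_assoc', div_le_iff₀ hRp] at h5
  have h6 : |betaCoeff A u j - betaCoeff A u' j| * D ≤ 3.5 * R * (2 * R) ^ m * dist u u' := by
    refine h5.trans ?_
    calc 3 * R * (2 * R) ^ j * dist u u' * R ^ (m - j)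
        = 3 * R * ((2 * R) ^ j * R ^ (m - j)) * dist u u' := by ring
      _ ≤ _ := by
        have := two_mul_pow_mul_pow_le hR.le hj.le
        gcongr
        norm_num
  rw [← le_div_iff₀ hD] at h6
  refine h6.trans (le_of_eq ?_)
  ring

theorem betaCoeff_pos {m j : ℕ} (hj : j < m) {u : Sphere n}
    (hu : 0 < betaProd A (toField 𝕜 (u : EuclideanSpace ℝ (Fin n))) m) :
    0 < betaCoeff A u j := by
  refine lt_of_le_of_ne (norm_nonneg _) fun h0 => hu.ne' ?_
  exact Finset.prod_eq_zero (Finset.mem_range.2 hj) h0.symm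

end

/-! ### Numerical estimates -/

theorem four_pow_ge {k : ℕ} (hk : 2 ≤ k) : (8 : ℝ) * k ≤ 4 ^ k := by
  induction k, hk using Nat.le_induction with
  | base => norm_num
  | succ k hk ih =>
    rw [pow_succ]
    push_cast
    have : (2 : ℝ) ≤ k := by exact_mod_cast hk
    linarith

theorem nat_le_two_pow (m : ℕ) : (m : ℝ) ≤ 2 ^ m := by
  exact_mod_cast (Nat.lt_two_pow_self (n := m)).le

/-- The failure probability of the union bound, for `s = √n` and `q = (ω / (4 ‖A‖)) ^ k`. -/
theorem pow_mul_exp_div_le {n k : ℕ} (hk : 2 ≤ k) {δ q Y : ℝ} (hδ : 0 < δ) (hδ1 : δ ≤ 1)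
    (hq : 0 < q) (hq4 : q * 4 ^ k ≤ 1) (hY : 2 < Y) (hYle : Y ≤ 1 / 192 * q ^ 2 * δ ^ 2 * n) :
    (n : ℝ) ^ (k - 1) * (Real.exp (-(0.0225 * (n * δ))) / (0.19 * δ)) ≤ Real.exp (-Y) := by
  set s := √(n : ℝ) with hs
  have hs0 : 0 ≤ s := Real.sqrt_nonneg _
  have hs2 : s ^ 2 = n := Real.sq_sqrt (Nat.cast_nonneg n)
  have h8 := four_pow_ge hk
  have hk2 : (2 : ℝ) ≤ k := by exact_mod_cast hk
  set F : ℝ := 4 ^ k with hF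
  have hF16 : 16 ≤ F := by linarith
  have hqs : 19.5 ≤ q * δ * s := by
    have h1 : (19.5 : ℝ) ^ 2 ≤ (q * δ * s) ^ 2 := by
      have : (q * δ * s) ^ 2 = q ^ 2 * δ ^ 2 * n := by rw [mul_pow, mul_pow, hs2]
      rw [this]; linarith
    exact (sq_le_sq₀ (by norm_num) (by positivity)).1 h1
  have hδs : 19.5 * F ≤ δ * s := by
    have h1 : q * F * (δ * s) ≤ 1 * (δ * s) := mul_le_mul_of_nonneg_right hq4 (by positivity)
    nlinarith
  have hnδ : 19.5 * F * s ≤ n * δ := by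
    rw [← hs2]; nlinarith
  have hYn : Y ≤ 0.0001 * (n * δ) := by
    have hq1 : q ≤ 1 / 16 := by
      rw [le_div_iff₀ (by norm_num)]
      nlinarith
    have hq2 : q ^ 2 ≤ 1 / 256 := by nlinarith
    have hδ2 : δ ^ 2 ≤ δ := by nlinarith
    have hn0 : (0 : ℝ) ≤ n := Nat.cast_nonneg n
    have : q ^ 2 * δ ^ 2 ≤ 1 / 256 * δ := mul_le_mul hq2 hδ2 (sq_nonneg _) (by norm_num)
    have h2 : q ^ 2 * δ ^ 2 * n ≤ 1 / 256 * δ * n := mul_le_mul_of_nonneg_right this hn0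
    have h3 : 0 ≤ δ * n := by positivity
    nlinarith
  have hse : s ≤ Real.exp s := by linarith [Real.add_one_le_exp s]
  have hpow : (n : ℝ) ^ (k - 1) ≤ Real.exp (2 * (k - 1 : ℝ) * s) := by
    have e : Real.exp (2 * (k - 1 : ℝ) * s) = (Real.exp s ^ 2) ^ (k - 1) := by
      rw [← pow_mul, ← Real.exp_nat_mul]
      congr 1
      rw [Nat.cast_mul, Nat.cast_sub (by omega)]
      push_cast
      ring
    rw [e, ← hs2]
    gcongr
  have hδe : 1 / (0.19 * δ) ≤ Real.exp s := by
    refine le_trans ?_ hse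
    rw [div_le_iff₀ (by positivity)]
    linarith
  calc (n : ℝ) ^ (k - 1) * (Real.exp (-(0.0225 * (n * δ))) / (0.19 * δ))
      = (n : ℝ) ^ (k - 1) * (1 / (0.19 * δ)) * Real.exp (-(0.0225 * (n * δ))) := by ring
    _ ≤ Real.exp (2 * (k - 1 : ℝ) * s) * Real.exp s * Real.exp (-(0.0225 * (n * δ))) := by
        gcongr
    _ = Real.exp (2 * (k - 1 : ℝ) * s + s + -(0.0225 * (n * δ))) := by
        rw [Real.exp_add, Real.exp_add]
    _ ≤ Real.exp (-Y) := by
        refine Real.exp_le_exp.2 ?_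
        have h1 : 8 * k * s ≤ F * s := mul_le_mul_of_nonneg_right h8 hs0
        nlinarith

/-- The rounding error of the roots is small compared with the lower bound. -/
theorem mul_pow_div_le {n m : ℕ} {R ω δ : ℝ} (hR : 0 < R) (hω : 0 < ω) (hωR : ω ≤ R)
    (hδ : 0 < δ) (hδ1 : δ ≤ 1)
    (h : 384 ≤ ((ω / (4 * R)) ^ (m + 1)) ^ 2 * δ ^ 2 * n) :
    m * (2 * R) ^ m / n ≤ 0.1 * (√δ * ω ^ m) := by
  have hn0 : (0 : ℝ) < n := by
    rcases Nat.eq_zero_or_pos n with h0 | h0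
    · subst h0; norm_num at h
    · exact_mod_cast h0
  set p := ω / (2 * R) with hp
  have hp0 : 0 < p := by positivity
  have hp1 : p ≤ 1 / 2 := by rw [hp, div_le_div_iff₀ (by positivity) (by norm_num)]; linarith
  have hωp : ω ^ m = p ^ m * (2 * R) ^ m := by rw [← mul_pow, hp, div_mul_cancel₀ _ (by positivity)]
  have hq : (ω / (4 * R)) ^ (m + 1) * 2 ^ m ≤ p ^ m / 4 := by
    have e : ω / (4 * R) = p / 2 := by rw [hp]; field_simp; norm_num
    rw [e, pow_succ, div_pow]
    have : (2 : ℝ) ^ m ≠ 0 := by positivity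
    field_simp
    linarith
  set q := (ω / (4 * R)) ^ (m + 1) with hqd
  have hq0 : 0 < q := by positivity
  have hq1 : q ≤ 1 := by
    have h1 : (1 : ℝ) ≤ 2 ^ m := one_le_pow₀ (by norm_num)
    have h2 : p ^ m ≤ 1 := pow_le_one₀ hp0.le (by linarith)
    nlinarith
  have hsq : δ ≤ √δ := Real.le_sqrt_of_sq_le (by nlinarith)
  have hs0 : 0 < √δ := Real.sqrt_pos.2 hδ
  have h1 : q ^ 2 * δ ^ 2 ≤ q * √δ := by
    have h2 : q ^ 2 ≤ q := by nlinarith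
    have h3 : δ ^ 2 ≤ √δ := by nlinarith
    exact mul_le_mul h2 h3 (sq_nonneg _) hq0.le
  have h2 : 384 ≤ q * √δ * n := h.trans (mul_le_mul_of_nonneg_right h1 hn0.le)
  have hm : (m : ℝ) ≤ 2 ^ m := nat_le_two_pow m
  have h3 : (m : ℝ) * q ≤ p ^ m / 4 := by nlinarith
  have h4 : (m : ℝ) ≤ 0.1 * (√δ * p ^ m) * n := by
    have h5 : (m : ℝ) * 384 ≤ m * (q * √δ * n) := mul_le_mul_of_nonneg_left h2 (Nat.cast_nonneg m)
    have h6 : (m * q) * (√δ * n) ≤ p ^ m / 4 * (√δ * n) :=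
      mul_le_mul_of_nonneg_right h3 (by positivity)
    have h7 : 0 ≤ √δ * p ^ m * n := by positivity
    nlinarith
  rw [div_le_iff₀ hn0, hωp]
  have h5 : 0 < (2 * R) ^ m := by positivity
  calc (m : ℝ) * (2 * R) ^ m ≤ 0.1 * (√δ * p ^ m) * n * (2 * R) ^ m := by gcongr
    _ = _ := by ring

/-- The exponent of the concentration inequality at distance `0.07 τ / K`, where
`τ = R n ^ (-c)` and `7 K` is the Lipschitz constant of the coefficients `α_j`, is at least twice
the exponent of the second term of the bound. -/
theorem two_mul_le_exponent {n m : ℕ} {R ω δ c : ℝ} (hn : n ≠ 0) (hR : 0 < R) (hω : 0 < ω)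
    (hωR : ω ≤ R) (hδ : 0 < δ) (hδ1 : δ ≤ 1) (hm : 0 < m) :
    2 * (1 / 192 * (ω / (4 * R)) ^ (2 * (m + 1)) * δ ^ 2 * (n : ℝ) ^ (1 - 2 * c)) ≤
      n * (0.07 * (R * (n : ℝ) ^ (-c)) / (R * (2 * R) ^ m / (0.5 * (√δ * ω ^ m)))) ^ 2 / 4 := by
  have hn0 : (0 : ℝ) < n := by exact_mod_cast Nat.pos_of_ne_zero hn
  have hs0 : 0 < √δ := Real.sqrt_pos.2 hδ
  set p := ω / (2 * R) with hp
  have hp0 : 0 < p := by positivity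
  have hp1 : p ≤ 1 / 2 := by rw [hp, div_le_div_iff₀ (by positivity) (by norm_num)]; linarith
  have e0 : (n : ℝ) ^ (1 - 2 * c) = n * ((n : ℝ) ^ (-c)) ^ 2 := by
    rw [← Real.rpow_natCast ((n : ℝ) ^ (-c)) 2, ← Real.rpow_mul hn0.le,
      sub_eq_add_neg, Real.rpow_add hn0, Real.rpow_one]
    congr 2
    push_cast
    ring
  set z := (n : ℝ) ^ (-c) with hz
  have e1 : 0.07 * (R * z) / (R * (2 * R) ^ m / (0.5 * (√δ * ω ^ m))) =
      0.035 * z * √δ * p ^ m := by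
    rw [hp, div_pow]
    field_simp
    ring
  have e2 : (0.035 * z * √δ * p ^ m) ^ 2 = 0.001225 * z ^ 2 * δ * (p ^ m) ^ 2 := by
    rw [mul_pow, mul_pow, mul_pow, Real.sq_sqrt hδ.le]; norm_num
  have e3 : (ω / (4 * R)) ^ (2 * (m + 1)) ≤ (p ^ m) ^ 2 / 64 := by
    have e : ω / (4 * R) = p / 2 := by rw [hp]; field_simp; norm_num
    have h2m : (2 : ℝ) ≤ 2 ^ m := by
      calc (2 : ℝ) = 2 ^ 1 := by norm_num
        _ ≤ 2 ^ m := pow_le_pow_right₀ (by norm_num) hm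
    have h1 : (p / 2) ^ (m + 1) ≤ p ^ m / 8 := by
      rw [pow_succ, div_pow]
      have h3 : p ^ m / 2 ^ m ≤ p ^ m / 2 := by gcongr
      have h4 : p / 2 ≤ 1 / 4 := by linarith
      calc p ^ m / 2 ^ m * (p / 2) ≤ p ^ m / 2 * (1 / 4) := by gcongr
        _ = _ := by ring
    rw [e, mul_comm, pow_mul]
    calc ((p / 2) ^ (m + 1)) ^ 2 ≤ (p ^ m / 8) ^ 2 := by gcongr
      _ = _ := by ring
  rw [e0, e1, e2]
  have hδ2 : δ ^ 2 ≤ δ := by nlinarith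
  have h5 : (ω / (4 * R)) ^ (2 * (m + 1)) * δ ^ 2 ≤ (p ^ m) ^ 2 / 64 * δ :=
    mul_le_mul e3 hδ2 (sq_nonneg _) (by positivity)
  have h6 : (ω / (4 * R)) ^ (2 * (m + 1)) * δ ^ 2 * (n * z ^ 2) ≤
      (p ^ m) ^ 2 / 64 * δ * (n * z ^ 2) := mul_le_mul_of_nonneg_right h5 (by positivity)
  have h7 : 0 ≤ (p ^ m) ^ 2 * δ * (n * z ^ 2) := by positivity
  nlinarith

end Lanczos

/-! ### Concentration of the eigenvectors of the Jacobi matrix -/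

namespace Lanczos

variable {𝕜 : Type*} [RCLike 𝕜] {n : ℕ} {A : Matrix (Fin n) (Fin n) 𝕜}

/-- With high probability all the entries of the Jacobi matrix are close to their medians, and then
its eigenvectors are close to those of the matrix of medians. -/
theorem unifSphere_sin_lineAngle_le (hA : A.IsHermitian) {δ ω : ℝ} (hδ : 0 < δ) (hω : 0 < ω)
    {k : ℕ} (hk : 2 ≤ k) (hequi : IsEquidistributed hA.eigenvalues δ ω k) {a b : ℕ → ℝ}
    (ha : ∀ j, j < k → IsMedian (unifSphere n) (fun u => alphaCoeff A u j) (a j))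
    (hb : ∀ j, j + 1 < k → IsMedian (unifSphere n) (fun u => betaCoeff A u j) (b j))
    {i : Fin k} {wt : EuclideanSpace ℝ (Fin k)} (hwt : IsRitzEigenvector k a b i wt)
    {w : Sphere n → EuclideanSpace ℝ (Fin k)}
    (hw : ∀ u, IsRitzEigenvector k (alphaCoeff A u) (betaCoeff A u) i (w u)) {ε : ℝ}
    (hε : IsLeast {x : ℝ | ∃ j : Fin k, j ≠ i ∧
      x = |ritzValue k a b i - ritzValue k a b j|} ε)
    {c : ℝ} (hc0 : 0 ≤ c) (hn : n ≠ 0) (hR : 0 < specNorm A) {Y : ℝ}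
    (hY : Y = 1 / 192 * (ω / (4 * specNorm A)) ^ (2 * k) * δ ^ 2 * (n : ℝ) ^ (1 - 2 * c))
    (hY1 : 4 * k * Real.exp (-Y) < 1) :
    (unifSphere n).real {u | 2 * specNorm A / (ε * (n : ℝ) ^ c) ≤
      Real.sin (lineAngle (w u) wt)} ≤ 4 * k * Real.exp (-Y) := by
  have := isProbabilityMeasure_unifSphere hn
  set R := specNorm A with hRdef
  obtain ⟨m, rfl⟩ : ∃ m, k = m + 1 := ⟨k - 1, by omega⟩
  have hm : 0 < m := by omega
  have hk2 : (2 : ℝ) ≤ ((m + 1 : ℕ) : ℝ) := by exact_mod_cast hk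
  have hn0 : (0 : ℝ) < n := by exact_mod_cast Nat.pos_of_ne_zero hn
  have hn1 : (1 : ℝ) ≤ n := by exact_mod_cast Nat.one_le_iff_ne_zero.2 hn
  -- consequences of equidistribution around the single point `0`
  obtain ⟨hωR, hδ1⟩ : ω ≤ R ∧ δ ≤ 1 := by
    obtain ⟨S, hS1, hS2⟩ := hequi.exists_finset hω one_pos (by omega)
      (t := fun _ : Fin 1 => 0) (Function.injective_of_subsingleton _)
    have hSpos : 0 < S.card := by
      have : (0 : ℝ) < S.card := lt_of_lt_of_le (by positivity) hS1
      exact_mod_cast this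
    obtain ⟨l, hl⟩ := Finset.card_pos.1 hSpos
    have h1 := hS2 l hl
    rw [eval_rootPoly] at h1
    simp only [pow_one, Finset.univ_unique, Finset.prod_const, sub_zero, Finset.card_singleton]
      at h1
    refine ⟨h1.trans (abs_eigenvalues_le hA l), ?_⟩
    have h2 : (S.card : ℝ) ≤ n := by
      have := Finset.card_le_univ S
      rw [Fintype.card_fin] at this
      exact_mod_cast this
    have h3 : δ * n ≤ 1 * n := by linarith
    exact le_of_mul_le_mul_right h3 hn0
  have hY2 : 2 < Y := by
    by_contra hcon
    have h1 : Real.exp (-2) ≤ Real.exp (-Y) := Real.exp_le_exp.2 (by linarith)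
    have h2 : (1 / 8 : ℝ) < Real.exp (-2) := by
      have h3 : Real.exp (-2) = Real.exp (-1) ^ 2 := by rw [← Real.exp_nat_mul]; norm_num
      rw [h3]
      nlinarith [Real.exp_neg_one_gt_d9]
    nlinarith
  set q := (ω / (4 * R)) ^ (m + 1) with hq
  have hq0 : 0 < q := by positivity
  have hq4 : q * 4 ^ (m + 1) ≤ 1 := by
    rw [hq, ← mul_pow]
    refine pow_le_one₀ (by positivity) ?_
    rw [div_mul_eq_mul_div, div_le_one (by positivity)]
    linarith
  have hYle : Y ≤ 1 / 192 * q ^ 2 * δ ^ 2 * n := by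
    rw [hY, mul_comm 2, pow_mul]
    refine mul_le_mul_of_nonneg_left ?_ (by positivity)
    calc (n : ℝ) ^ (1 - 2 * c) ≤ (n : ℝ) ^ (1 : ℝ) :=
          Real.rpow_le_rpow_of_exponent_le hn1 (by linarith)
      _ = n := Real.rpow_one _
  set D := 0.5 * (√δ * ω ^ m) with hD
  have hsδ : 0 < √δ := Real.sqrt_pos.2 hδ
  have hD0 : 0 < D := by positivity
  set Ω : Set (Sphere n) :=
    {u | D ≤ betaProd A (toField 𝕜 (u : EuclideanSpace ℝ (Fin n))) m} with hΩ
  have hΩc : (unifSphere n).real Ωᶜ ≤ Real.exp (-Y) := by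
    have e : Ωᶜ =
        {u : Sphere n | betaProd A (toField 𝕜 (u : EuclideanSpace ℝ (Fin n))) m < D} := by
      ext u
      simp [hΩ]
    rw [e]
    refine (unifSphere_betaProd_lt hA hequi hδ hω hn hR hm (by omega) ?_).trans
      (pow_mul_exp_div_le hk hδ hδ1 hq0 hq4 hY2 hYle)
    exact mul_pow_div_le hR hω hωR hδ hδ1 (by linarith)
  have hΩ8 : (unifSphere n).real Ωᶜ ≤ 1 / 8 := by nlinarith [Real.exp_pos (-Y)]
  -- deviations of size `0.49 τ` and `0.245 τ` of the diagonal and off-diagonal entries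
  set τ := R * (n : ℝ) ^ (-c) with hτ
  have hτ0 : 0 < τ := by positivity
  set K := R * (2 * R) ^ m / D with hK
  have hK0 : 0 < K := by positivity
  have hexp : 2 * Y ≤ n * (0.07 * τ / K) ^ 2 / 4 := by
    rw [hY]
    exact two_mul_le_exponent hn hR hω hωR hδ hδ1 hm
  have htail : ∀ (X : Sphere n → ℝ) (L t M : ℝ), 0 < L → 0 ≤ t → t / L = 0.07 * τ / K →
      (∀ u ∈ Ω, ∀ u' ∈ Ω, |X u - X u'| ≤ L * dist u u') → IsMedian (unifSphere n) X M →
      (unifSphere n).real {u | u ∈ Ω ∧ t ≤ |X u - M|} ≤ 16 / 3 * Real.exp (-Y) ^ 2 := by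
    intro X L t M hL ht htL hX hM
    refine (unifSphere_abs_sub_median hn hΩ8 hL hX hM ht).trans ?_
    rw [htL, ← Real.exp_nat_mul]
    refine mul_le_mul_of_nonneg_left (Real.exp_le_exp.2 ?_) (by norm_num)
    push_cast
    linarith
  set BA : Fin (m + 1) → Set (Sphere n) :=
    fun j => {u | u ∈ Ω ∧ 0.49 * τ ≤ |alphaCoeff A u j - a j|} with hBA
  set BB : Fin m → Set (Sphere n) :=
    fun j => {u | u ∈ Ω ∧ 0.245 * τ ≤ |betaCoeff A u j - b j|} with hBB
  have hBAle : ∀ j, (unifSphere n).real (BA j) ≤ 16 / 3 * Real.exp (-Y) ^ 2 := fun j =>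
    htail (fun u => alphaCoeff A u j) (7 * K) _ _ (by positivity) (by positivity)
      (by field_simp; norm_num)
      (fun u hu u' hu' => abs_alphaCoeff_sub_le hA hR (by omega) hD0 hu hu')
      (ha j j.2)
  have hBBle : ∀ j, (unifSphere n).real (BB j) ≤ 16 / 3 * Real.exp (-Y) ^ 2 := fun j =>
    htail (fun u => betaCoeff A u j) (3.5 * K) _ _ (by positivity) (by positivity)
      (by field_simp; norm_num)
      (fun u hu u' _ => abs_betaCoeff_sub_le hA hR j.2 hD0 hu)
      (hb j (by omega))
  -- the medians of the off-diagonal entries are positive, so the median matrix has simple spectrum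
  have hbpos : ∀ j, j + 1 < m + 1 → 0 < b j := by
    intro j hj
    have h1 : 1 / 2 ≤ (unifSphere n).real {u | betaCoeff A u j ≤ b j} := by
      have := ENNReal.toReal_mono (measure_ne_top (unifSphere n) _) (hb j hj).1
      simpa [Measure.real] using this
    have h2 : ¬ {u : Sphere n | betaCoeff A u j ≤ b j} ⊆ Ωᶜ := by
      intro hsub
      have := measureReal_mono (μ := unifSphere n) hsub (measure_ne_top _ _)
      linarith
    obtain ⟨u, hu1, hu2⟩ := Set.not_subset.1 h2
    have hu3 : u ∈ Ω := not_not.1 hu2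
    rw [Set.mem_ofPred_eq] at hu1
    refine lt_of_lt_of_le (betaCoeff_pos (A := A) (m := m) (by omega) ?_) hu1
    exact hD0.trans_le hu3
  have hε0 : 0 < ε := by
    obtain ⟨j, hj, hjε⟩ := hε.1
    rw [hjε, abs_pos, sub_ne_zero]
    exact fun h => hj (ritzValue_injective (fun l hl => (hbpos l hl).ne') h).symm
  have hsub : {u | 2 * R / (ε * (n : ℝ) ^ c) ≤ Real.sin (lineAngle (w u) wt)} ⊆
      Ωᶜ ∪ ((⋃ j, BA j) ∪ ⋃ j, BB j) := by
    intro u hu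
    by_contra hcon
    rw [Set.mem_union, Set.mem_union, Set.mem_iUnion, Set.mem_iUnion] at hcon
    push Not at hcon
    obtain ⟨h1, h2, h3⟩ := hcon
    have huΩ : u ∈ Ω := not_not.1 h1
    have h4 := mul_sin_lineAngle_le (a := a) (b := b) (s := 0.49 * τ) (t := 0.245 * τ)
      (by positivity) (by positivity)
      (fun j hj => by
        have := h2 ⟨j, hj⟩
        rw [abs_sub_comm]
        by_contra hlt
        exact this ⟨huΩ, (not_le.1 hlt).le⟩)
      (fun j hj => by
        have := h3 ⟨j, by omega⟩
        rw [abs_sub_comm]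
        by_contra hlt
        exact this ⟨huΩ, (not_le.1 hlt).le⟩)
      hε0 (fun j hj => hε.2 ⟨j, hj, rfl⟩) (hw u) hwt
    rw [Set.mem_ofPred_eq] at hu
    have h5 : 2 * R / (ε * (n : ℝ) ^ c) = 2 * τ / ε := by
      rw [hτ, Real.rpow_neg hn0.le]
      field_simp
    rw [h5, div_le_iff₀ hε0] at hu
    linarith
  have hsum : (unifSphere n).real (Ωᶜ ∪ ((⋃ j, BA j) ∪ ⋃ j, BB j)) ≤
      Real.exp (-Y) + ((m + 1) * (16 / 3 * Real.exp (-Y) ^ 2) +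
        m * (16 / 3 * Real.exp (-Y) ^ 2)) := by
    refine (measureReal_union_le _ _).trans (add_le_add hΩc ?_)
    refine (measureReal_union_le _ _).trans (add_le_add ?_ ?_)
    · refine (measureReal_iUnion_fintype_le BA).trans
        ((Finset.sum_le_sum fun j _ => hBAle j).trans (le_of_eq ?_))
      simp
    · refine (measureReal_iUnion_fintype_le BB).trans
        ((Finset.sum_le_sum fun j _ => hBBle j).trans (le_of_eq ?_))
      simp
  refine (measureReal_mono hsub (measure_ne_top _ _)).trans (hsum.trans ?_)
  set E := Real.exp (-Y) with hE
  have hE0 : 0 < E := Real.exp_pos _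
  push_cast at hY1 hk2 ⊢
  have h6 : 4 * ((m : ℝ) + 1) * E * E ≤ 1 * E := mul_le_mul_of_nonneg_right hY1.le hE0.le
  have h7 : 2 * E ≤ ((m : ℝ) + 1) * E := mul_le_mul_of_nonneg_right hk2 hE0.le
  nlinarith [sq_nonneg E]

end Lanczos

end

theorem proposition4p18 {𝕜 : Type*} [RCLike 𝕜] {n : ℕ}
    (A : Matrix (Fin n) (Fin n) 𝕜) (hA : A.IsHermitian)
    (δ ω : ℝ) (hδ : 0 < δ) (hω : 0 < ω) (k : ℕ)
    (hequi : Lanczos.IsEquidistributed hA.eigenvalues δ ω k)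
    -- medians of the Jacobi coefficients
    (a b : ℕ → ℝ)
    (ha : ∀ j, j < k →
      Lanczos.IsMedian (Lanczos.unifSphere n) (fun u => Lanczos.alphaCoeff A u j) (a j))
    (hb : ∀ j, j + 1 < k →
      Lanczos.IsMedian (Lanczos.unifSphere n) (fun u => Lanczos.betaCoeff A u j) (b j))
    (i : Fin k)
    -- the eigenvectors of the median Jacobi matrix and of the random Jacobi matrix
    (wt : EuclideanSpace ℝ (Fin k)) (hwt : Lanczos.IsRitzEigenvector k a b i wt)
    (w : Lanczos.Sphere n → EuclideanSpace ℝ (Fin k))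
    (hw : ∀ u, Lanczos.IsRitzEigenvector k
      (Lanczos.alphaCoeff A u) (Lanczos.betaCoeff A u) i (w u))
    -- the gap; the minimum exists exactly when `2 ≤ k`
    (ε : ℝ)
    (hε : IsLeast {x : ℝ | ∃ j : Fin k, j ≠ i ∧
      x = |Lanczos.ritzValue k a b i - Lanczos.ritzValue k a b j|} ε)
    (c : ℝ) (hc0 : 0 ≤ c) (hc : c < 1 / 2) :
    (Lanczos.unifSphere n).real
        {u | 2 * Lanczos.specNorm A / (ε * (n : ℝ) ^ c) ≤
          Real.sin (Lanczos.lineAngle (w u) wt)} ≤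
      4 * (k : ℝ) *
        (Real.exp (-((min δ (1 / 50)) ^ 2 / 32 * (n : ℝ))) +
          Real.exp (-((1 / 192) * (ω / (4 * Lanczos.specNorm A)) ^ (2 * k) * δ ^ 2 *
            (n : ℝ) ^ (1 - 2 * c)))) := by
  have hk : 2 ≤ k := by
    obtain ⟨j, hj, -⟩ := hε.1
    by_contra hlt
    exact hj (Fin.ext (by omega))
  have hk0 : (0 : ℝ) ≤ 4 * k := by positivity
  set Y := 1 / 192 * (ω / (4 * Lanczos.specNorm A)) ^ (2 * k) * δ ^ 2 * (n : ℝ) ^ (1 - 2 * c)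
    with hY
  have hle : 4 * (k : ℝ) * Real.exp (-Y) ≤ 4 * (k : ℝ) *
      (Real.exp (-((min δ (1 / 50)) ^ 2 / 32 * (n : ℝ))) + Real.exp (-Y)) :=
    mul_le_mul_of_nonneg_left (le_add_of_nonneg_left (Real.exp_pos _).le) hk0
  refine le_trans ?_ hle
  rcases le_or_gt 1 (4 * (k : ℝ) * Real.exp (-Y)) with h1 | h1
  · exact (Lanczos.unifSphere_real_le_one _).trans h1
  -- in the degenerate cases `n = 0` and `A = 0` the bound exceeds `1`
  have hY0 : Y ≠ 0 := by
    intro h0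
    have hk2 : (2 : ℝ) ≤ k := by exact_mod_cast hk
    rw [h0, neg_zero, Real.exp_zero] at h1
    linarith
  have hn : n ≠ 0 := by
    rintro rfl
    apply hY0
    rw [hY, Nat.cast_zero, Real.zero_rpow (by linarith), mul_zero]
  have hR : 0 < Lanczos.specNorm A := by
    refine lt_of_le_of_ne (Lanczos.specNorm_nonneg A) fun h0 => hY0 ?_
    rw [hY, ← h0, mul_zero, div_zero, zero_pow (by omega)]
    ring
  exact Lanczos.unifSphere_sin_lineAngle_le hA hδ hω hk hequi ha hb hwt hw hε hc0 hn hR hY h1
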